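/- Let $k$ be an algebraically closed field of characteristic $0$ and let $H$ be a finite-dimensional semisimple Hopf algebra over $k$ with comultiplication $\Delta(h)=h_{(1)}\otimes h_{(2)}$, counit $\varepsilon$ and antipode $S$. Then $S^2=\mathrm{id}_H$, and $H$ has a unique Haar integral $\Lambda$, i.e. a unique two-sided integral ($h\Lambda=\varepsilon(h)\Lambda=\Lambda h$ for all $h\in H$) with $\varepsilon(\Lambda)=1$. Let $\alpha: H\to k$ be an algebra map such that $\alpha(h_{(1)})\,h_{(2)}=\alpha(h_{(2)})\,h_{(1)}$ for all $h\in H$ (equivalently, $\alpha$ is a central grouplike element of the dual Hopf algebra $H^\vee$), and let $L=k$ be the one-dimensional left $H$-module on which $h$ acts as multiplication by $\alpha(h)$. For finite-dimensional left $H$-modules, let $V^\vee=\mathrm{Hom}_k(V,k)$ with $(hf)(v)=f(S(h)v)$, let $H$ act on tensor products through $\Delta$, and put $V^\sharp=L\otimes V^\vee$ and $f^\sharp=\mathrm{id}_L\otimes f^\vee$ for an $H$-linear map $f$. Let $\omega_V: V\to V^{\sharp\sharp}$ be the $H$-linear map which is the composite $$V\to L\otimes L^\vee\otimes V\to L\otimes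 L^\vee\otimes V^{\vee\vee}\to L\otimes(L\otimes V^\vee)^\vee$$ of the map $v\mapsto\sum_i \ell_i\otimes\ell_i^\vee\otimes v$ (where $\{\ell_i\}$ is a basis of $L$ and $\{\ell_i^\vee\}$ its dual basis), the map induced by the canonical map $V\to V^{\vee\vee}$, and the map induced by $L^\vee\otimes V^{\vee\vee}\to(L\otimes V^\vee)^\vee$, $\lambda\otimes\phi\mapsto(\ell\otimes f\mapsto\lambda(\ell)\phi(f))$. The twisted Frobenius–Schur indicator $\nu(V;L)\in k$ is the trace of the linear map $$\mathrm{Hom}_H(V,V^\sharp)\to\mathrm{Hom}_H(V,V^\sharp),\qquad f\mapsto f^\sharp\circ\omega_V .$$ Then, for every simple $V$, with character $\chi_V$, $$\nu(V;L)=\alpha(S(\Lambda_{(1)}))\,\chi_V(\Lambda_{(2)}\Lambda_{(3)})\in\{0,\pm1\}.$$ Moreover, for a simple $V$ the following are equivalent: 1. $\nu(V;L)\neq0$; 2. $V\cong L\otimes V^\vee$ as $H$-modules; 3. there is a non-degenerate bilinear form $b: V\times V\to k$ with $b(h_{(1)}v,h_{(2)}w)=\alpha(h)\,b(v,w)$ for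 all $h\in H$ and $v,w\in V$. If these hold, the form $b$ in (3) is unique up to (nonzero) scalar multiples, and $b(w,v)=\nu(V;L)\,b(v,w)$ for all $v,w\in V$. -/

import Mathlib

open scoped TensorProduct

noncomputable section

namespace HopfRep

open Coalgebra HopfAlgebra WithConv

/-! A left module over a `k`-algebra `H` with underlying vector space `V` is written as an algebra
map `ρ : H →ₐ[k] Module.End k V`. -/

section Reps

variable {k H : Type*} [Field k] [Ring H] [HopfAlgebra k H]
variable {U V W : Type*} [AddCommGroup U] [Module k U] [AddCommGroup V] [Module k V]
  [AddCommGroup W] [Module k W]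

/-- The `k`-space `Hom_H(V, W)` of `H`-linear maps. -/
def homH (ρ : H →ₐ[k] Module.End k V) (σ : H →ₐ[k] Module.End k W) :
    Submodule k (V →ₗ[k] W) where
  carrier := {f | ∀ h v, f (ρ h v) = σ h (f v)}
  add_mem' hf hg h v := by simp [hf h v, hg h v]
  zero_mem' h v := by simp
  smul_mem' c f hf h v := by simp [hf h v]

/-- Two `H`-modules are isomorphic. -/
def IsIso (ρ : H →ₐ[k] Module.End k V) (σ : H →ₐ[k] Module.End k W) : Prop :=
  ∃ e : V ≃ₗ[k] W, (e : V →ₗ[k] W) ∈ homH ρ σ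

/-- The dual module: `(h f)(v) = f (S(h) v)`. -/
def dualRep (ρ : H →ₐ[k] Module.End k V) : H →ₐ[k] Module.End k (Module.Dual k V) :=
  AlgHom.ofLinearMap
    (Module.Dual.transpose ∘ₗ ρ.toLinearMap ∘ₗ antipode k)
    (by ext; simp [Module.Dual.transpose])
    (fun x y => by ext; simp [Module.Dual.transpose, antipode_mul_antidistrib])

/-- The tensor product of modules: `h (v ⊗ w) = h₍₁₎ v ⊗ h₍₂₎ w`. -/
def tensorRep (ρ : H →ₐ[k] Module.End k V) (σ : H →ₐ[k] Module.End k W) :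
    H →ₐ[k] Module.End k (V ⊗[k] W) :=
  (Module.endTensorEndAlgHom.comp (Algebra.TensorProduct.map ρ σ)).comp
    (Bialgebra.comulAlgHom k H)

/-- The one-dimensional module attached to an algebra map `α : H → k`: it is `k` with
`h c = α(h) c`. -/
def charRep (α : H →ₐ[k] k) : H →ₐ[k] Module.End k k :=
  (Algebra.lsmul k k k).comp α

/-- The module `ρ` satisfies `h₍₁₎ v ⊗ h₍₂₎ = h₍₂₎ v ⊗ h₍₁₎` in `V ⊗ H`. -/
def IsFlippable (ρ : H →ₐ[k] Module.End k V) : Prop :=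
  ∀ (h : H) (v : V), (ρ.toLinearMap.flip v).rTensor H (comul h) =
    (ρ.toLinearMap.flip v).rTensor H (TensorProduct.comm k H H (comul h))

/-- The algebra map `α` satisfies `α(h₍₁₎) h₍₂₎ = α(h₍₂₎) h₍₁₎`. -/
def IsCentralChar (α : H →ₐ[k] k) : Prop :=
  ∀ h : H, TensorProduct.lid k H (α.toLinearMap.rTensor H (comul h)) =
    TensorProduct.rid k H (α.toLinearMap.lTensor H (comul h))

variable (k H V) in
/-- The algebra map `H → End_k(V)` given by the action on an `H`-module `V`. -/
abbrev actRep [Module H V] [IsScalarTower k H V] : H →ₐ[k] Module.End k V :=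
  Algebra.lsmul k k V

variable (k H) in
/-- The Hopf algebra is involutory: `S² = id`. -/
def IsInvolutory : Prop := ∀ h : H, antipode k (antipode k h) = h

variable (k) in
/-- `Λ` is a Haar integral: a two-sided integral with `ε(Λ) = 1`. -/
def IsHaarIntegral (Λ : H) : Prop :=
  (∀ h : H, h * Λ = counit (R := k) h • Λ) ∧ (∀ h : H, Λ * h = counit (R := k) h • Λ) ∧
    counit (R := k) Λ = 1

/-- The linear functional `h ↦ α(S(h₍₁₎)) χ_V(h₍₂₎ h₍₃₎)`, with `χ_V` the character of `ρ`. -/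
def indicatorFunctional (α : H →ₐ[k] k) (ρ : H →ₐ[k] Module.End k V) : H →ₗ[k] k :=
  LinearMap.mul' k k ∘ₗ
    TensorProduct.map (α.toLinearMap ∘ₗ antipode k)
      (LinearMap.trace k V ∘ₗ ρ.toLinearMap ∘ₗ LinearMap.mul' k H ∘ₗ comul) ∘ₗ
    comul

/-- The bilinear form `b` satisfies `b(h₍₁₎ v, h₍₂₎ w) = α(h) b(v, w)`. -/
def IsInvariantForm (α : H →ₐ[k] k) (ρ : H →ₐ[k] Module.End k V)
    (b : LinearMap.BilinForm k V) : Prop :=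
  ∀ (h : H) (v w : V), TensorProduct.lift b (tensorRep ρ ρ h (v ⊗ₜ[k] w)) = α h * b v w

/-! ### Basic facts -/

lemma dualRep_apply (ρ : H →ₐ[k] Module.End k V) (h : H) (f : Module.Dual k V) (v : V) :
    dualRep ρ h f v = f (ρ (antipode k h) v) := rfl

lemma charRep_apply (α : H →ₐ[k] k) (h : H) (c : k) : charRep α h c = α h * c := rfl

lemma tensorRep_repr {ι : Type*} (ρ : H →ₐ[k] Module.End k V) (σ : H →ₐ[k] Module.End k W)
    {h : H} (r : Repr k h ι) :
    tensorRep ρ σ h = ∑ i ∈ r.index, TensorProduct.map (ρ (r.left i)) (σ (r.right i)) := by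
  simp only [tensorRep, AlgHom.comp_apply, Bialgebra.comulAlgHom_apply, ← r.eq, map_sum,
    Algebra.TensorProduct.map_tmul]
  rfl

lemma IsCentralChar.isFlippable {α : H →ₐ[k] k} (hα : IsCentralChar α) :
    IsFlippable (charRep α) := by
  intro h c
  apply (TensorProduct.lid k H).injective
  have key : ∀ t : H ⊗[k] H, TensorProduct.lid k H
      (((charRep α).toLinearMap.flip c).rTensor H t) =
      c • TensorProduct.lid k H (α.toLinearMap.rTensor H t) := by
    intro t
    induction t with
    | zero => simp
    | tmul x y => simp [charRep_apply, mul_comm, mul_smul]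
    | add x y hx hy => simp only [map_add, hx, hy, smul_add]
  have key2 : ∀ t : H ⊗[k] H,
      TensorProduct.lid k H (α.toLinearMap.rTensor H (TensorProduct.comm k H H t)) =
      TensorProduct.rid k H (α.toLinearMap.lTensor H t) := by
    intro t
    induction t with
    | zero => simp
    | tmul x y => simp
    | add x y hx hy => simp only [map_add, hx, hy]
  rw [key, key, key2, hα h]

/-- The condition on `α` says that `α` is central in the dual algebra of `H`, whose product is
convolution. (An algebra map `H → k` is the same thing as a grouplike element of the dual.) -/
lemma isCentralChar_iff_central (α : H →ₐ[k] k) :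
    IsCentralChar α ↔ ∀ f : WithConv (H →ₗ[k] k),
      toConv α.toLinearMap * f = f * toConv α.toLinearMap := by
  have h1 : ∀ (f : H →ₗ[k] k) (h : H), (toConv α.toLinearMap * toConv f) h =
      f (TensorProduct.lid k H (α.toLinearMap.rTensor H (comul h))) := by
    intro f h
    rw [(ℛ k h).convMul_apply, ← (ℛ k h).eq]
    simp
  have h2 : ∀ (f : H →ₗ[k] k) (h : H), (toConv f * toConv α.toLinearMap) h =
      f (TensorProduct.rid k H (α.toLinearMap.lTensor H (comul h))) := by
    intro f h
    rw [(ℛ k h).convMul_apply, ← (ℛ k h).eq]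
    simp [mul_comm]
  constructor
  · intro hα f
    ext h
    exact (h1 f.ofConv h).trans ((congrArg f.ofConv (hα h)).trans (h2 f.ofConv h).symm)
  · intro hα h
    rw [← sub_eq_zero]
    apply (Module.forall_dual_apply_eq_zero_iff k _).1
    intro f
    rw [map_sub, sub_eq_zero, ← h1, ← h2, hα]

/-- The antipode is anti-comultiplicative: `Δ(S(h)) = S(h₍₂₎) ⊗ S(h₍₁₎)`. -/
lemma comul_antipode (h : H) :
    comul (R := k) (antipode k h) =
      TensorProduct.map (antipode k) (antipode k) (TensorProduct.comm k H H (comul h)) := by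
  let i₁ : H →ₐ[k] H ⊗[k] H := Algebra.TensorProduct.includeLeft
  let i₂ : H →ₐ[k] H ⊗[k] H := Algebra.TensorProduct.includeRight
  let I₁ : WithConv (H →ₗ[k] H ⊗[k] H) := toConv i₁.toLinearMap
  let I₂ : WithConv (H →ₗ[k] H ⊗[k] H) := toConv i₂.toLinearMap
  let J₁ : WithConv (H →ₗ[k] H ⊗[k] H) := toConv (i₁.toLinearMap ∘ₗ antipode k)
  let J₂ : WithConv (H →ₗ[k] H ⊗[k] H) := toConv (i₂.toLinearMap ∘ₗ antipode k)
  let D : WithConv (H →ₗ[k] H ⊗[k] H) := toConv comul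
  let G : WithConv (H →ₗ[k] H ⊗[k] H) := toConv (TensorProduct.map (antipode k) (antipode k) ∘ₗ
    (TensorProduct.comm k H H).toLinearMap ∘ₗ comul)
  have hD : D = I₁ * I₂ := by
    ext x
    rw [(ℛ k x).convMul_apply]
    simp [D, I₁, I₂, i₁, i₂, (ℛ k x).eq]
  have hG : G = J₂ * J₁ := by
    ext x
    rw [(ℛ k x).convMul_apply]
    simp [G, J₁, J₂, i₁, i₂, ← (ℛ k x).eq]
  have h1 : J₁ * I₁ = 1 := by
    ext x
    rw [(ℛ k x).convMul_apply]
    simp only [J₁, I₁, LinearMap.comp_apply, AlgHom.toLinearMap_apply, ← map_mul,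
      ← map_sum, sum_antipode_mul_eq_algebraMap_counit]
    simp
  have h2 : J₂ * I₂ = 1 := by
    ext x
    rw [(ℛ k x).convMul_apply]
    simp only [J₂, I₂, LinearMap.comp_apply, AlgHom.toLinearMap_apply, ← map_mul,
      ← map_sum, sum_antipode_mul_eq_algebraMap_counit]
    simp
  have hGD : G * D = 1 := by
    rw [hG, hD, mul_assoc, ← mul_assoc J₁, h1, one_mul, h2]
  have := left_inv_eq_right_inv hGD (LinearMap.comul_right_inv (R := k) (C := H))
  exact (congr($(this) h)).symm

lemma tensorRep_map_mem {U' : Type*} [AddCommGroup U'] [Module k U']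
    {ρ : H →ₐ[k] Module.End k U} {ρ' : H →ₐ[k] Module.End k U'}
    {σ : H →ₐ[k] Module.End k V} {τ : H →ₐ[k] Module.End k W}
    {f : U →ₗ[k] V} {g : U' →ₗ[k] W} (hf : f ∈ homH ρ σ) (hg : g ∈ homH ρ' τ) :
    TensorProduct.map f g ∈ homH (tensorRep ρ ρ') (tensorRep σ τ) := by
  intro h t
  rw [tensorRep_repr _ _ (ℛ k h), tensorRep_repr _ _ (ℛ k h)]
  induction t with
  | zero => simp
  | tmul x y => simp [hf _ _, hg _ _]
  | add x y hx hy => simp only [map_add, hx, hy]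

lemma lTensor_mem {ρ : H →ₐ[k] Module.End k U}
    {σ : H →ₐ[k] Module.End k V} {τ : H →ₐ[k] Module.End k W}
    {f : V →ₗ[k] W} (hf : f ∈ homH σ τ) :
    f.lTensor U ∈ homH (tensorRep ρ σ) (tensorRep ρ τ) :=
  tensorRep_map_mem (fun _ _ => rfl) hf

lemma dualMap_mem {σ : H →ₐ[k] Module.End k V} {τ : H →ₐ[k] Module.End k W}
    {f : V →ₗ[k] W} (hf : f ∈ homH σ τ) : f.dualMap ∈ homH (dualRep τ) (dualRep σ) := by
  intro h φ
  ext v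
  simp [dualRep_apply, hf _ _]

lemma comp_mem {ρ : H →ₐ[k] Module.End k U}
    {σ : H →ₐ[k] Module.End k V} {τ : H →ₐ[k] Module.End k W}
    {f : U →ₗ[k] V} {g : V →ₗ[k] W} (hf : f ∈ homH ρ σ) (hg : g ∈ homH σ τ) :
    g ∘ₗ f ∈ homH ρ τ := by
  intro h v
  simp [hf _ _, hg _ _]

lemma eval_mem (hS : IsInvolutory k H) (ρ : H →ₐ[k] Module.End k V) :
    Module.Dual.eval k V ∈ homH ρ (dualRep (dualRep ρ)) := by
  intro h v
  ext φ
  simp [dualRep_apply, hS h]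

lemma assoc_mem (ρ : H →ₐ[k] Module.End k U) (σ : H →ₐ[k] Module.End k V)
    (τ : H →ₐ[k] Module.End k W) :
    (TensorProduct.assoc k U V W).toLinearMap ∈
      homH (tensorRep (tensorRep ρ σ) τ) (tensorRep ρ (tensorRep σ τ)) := by
  intro h t
  let M : H ⊗[k] (H ⊗[k] H) →ₗ[k] Module.End k (U ⊗[k] (V ⊗[k] W)) :=
    TensorProduct.homTensorHomMap (RingHom.id k) _ _ _ _ ∘ₗ TensorProduct.map ρ.toLinearMap
      (TensorProduct.homTensorHomMap (RingHom.id k) _ _ _ _ ∘ₗ TensorProduct.map σ.toLinearMap τ.toLinearMap)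
  have e1 : tensorRep ρ (tensorRep σ τ) h = M (comul.lTensor H (comul h)) := by
    rw [tensorRep_repr _ _ (ℛ k h), ← (ℛ k h).eq]
    simp only [map_sum, LinearMap.lTensor_tmul]
    refine Finset.sum_congr rfl fun i _ => ?_
    rw [tensorRep_repr _ _ (ℛ k ((ℛ k h).right i)), ← (ℛ k ((ℛ k h).right i)).eq]
    simp only [TensorProduct.tmul_sum, map_sum]
    exact map_sum (TensorProduct.mapBilinear (RingHom.id k) U (V ⊗[k] W) U (V ⊗[k] W)
      (ρ ((ℛ k h).left i))) _ _
  rw [e1, ← coassoc_apply, tensorRep_repr _ _ (ℛ k h), ← (ℛ k h).eq]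
  simp only [map_sum, LinearMap.rTensor_tmul, LinearMap.sum_apply]
  refine Finset.sum_congr rfl fun i _ => ?_
  rw [tensorRep_repr _ _ (ℛ k ((ℛ k h).left i)), ← (ℛ k ((ℛ k h).left i)).eq]
  have hl : TensorProduct.map (∑ j ∈ (ℛ k ((ℛ k h).left i)).index,
      TensorProduct.map (ρ ((ℛ k ((ℛ k h).left i)).left j)) (σ ((ℛ k ((ℛ k h).left i)).right j)))
        (τ ((ℛ k h).right i)) = ∑ j ∈ (ℛ k ((ℛ k h).left i)).index,
      TensorProduct.map (TensorProduct.map (ρ ((ℛ k ((ℛ k h).left i)).left j))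
        (σ ((ℛ k ((ℛ k h).left i)).right j))) (τ ((ℛ k h).right i)) :=
    map_sum ((TensorProduct.mapBilinear (RingHom.id k) (U ⊗[k] V) W (U ⊗[k] V) W).flip
      (τ ((ℛ k h).right i))) _ _
  rw [hl]
  simp only [TensorProduct.sum_tmul, map_sum, LinearMap.sum_apply]
  refine Finset.sum_congr rfl fun j _ => ?_
  induction t with
  | zero => simp
  | add x y hx hy => simp only [map_add, hx, hy]
  | tmul x y =>
    induction x with
    | zero => simp
    | add x x' hx hy => simp only [TensorProduct.add_tmul, map_add, hx, hy]
    | tmul x z => simp [M]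

/-- The coevaluation tensor `∑ ℓᵢ ⊗ ℓᵢ^∨` is `H`-invariant. -/
lemma tensorRep_coevaluation [FiniteDimensional k V] (ρ : H →ₐ[k] Module.End k V) (h : H) :
    tensorRep ρ (dualRep ρ) h (coevaluation k V 1) =
      counit (R := k) h • coevaluation k V 1 := by
  have inj : Function.Injective (dualTensorHom k V V ∘ₗ
      (TensorProduct.comm k V (Module.Dual k V)).toLinearMap) := by
    have := (dualTensorHomEquiv k V V).injective
    intro x y hxy
    apply (TensorProduct.comm k V (Module.Dual k V)).injective
    apply this
    simpa using hxy
  apply inj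
  have hc : (dualTensorHom k V V ∘ₗ
      (TensorProduct.comm k V (Module.Dual k V)).toLinearMap) (coevaluation k V 1) = 1 := by
    ext v
    simp only [coevaluation_apply_one, map_sum, LinearMap.sum_apply, LinearMap.comp_apply,
      LinearEquiv.coe_coe, TensorProduct.comm_tmul, dualTensorHom_apply, Module.End.one_apply]
    exact (Module.Basis.ofVectorSpace k V).sum_repr v
  have hAB : ∀ (A B : Module.End k V) (t : V ⊗[k] Module.Dual k V),
      (dualTensorHom k V V ∘ₗ (TensorProduct.comm k V (Module.Dual k V)).toLinearMap)
        (TensorProduct.map A (Module.Dual.transpose B) t) =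
      A * (dualTensorHom k V V ∘ₗ (TensorProduct.comm k V (Module.Dual k V)).toLinearMap) t
        * B := by
    intro A B t
    induction t with
    | zero => simp
    | add x y hx hy => simp only [map_add, hx, hy, mul_add, add_mul]
    | tmul x y => ext v; simp [Module.Dual.transpose]
  have hd : ∀ x, dualRep ρ x = Module.Dual.transpose (ρ (antipode k x)) := fun _ => rfl
  rw [tensorRep_repr _ _ (ℛ k h), map_smul, hc]
  simp only [LinearMap.sum_apply, map_sum, hd, hAB, hc, mul_one, ← map_mul]
  rw [← map_sum, sum_mul_antipode_eq_smul]
  simp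

end Reps

/-! ### The twisted duality on finite-dimensional modules -/

section Twisted

variable {k H : Type*} [Field k] [Ring H] [HopfAlgebra k H]
variable {L X Y : Type*} [AddCommGroup L] [Module k L]
  [AddCommGroup X] [Module k X] [AddCommGroup Y] [Module k Y]

/-- The twisted dual `X^♯ = L ⊗ X^∨`. -/
abbrev sharpRep (σ : H →ₐ[k] Module.End k L) (ρ : H →ₐ[k] Module.End k X) :
    H →ₐ[k] Module.End k (L ⊗[k] Module.Dual k X) :=
  tensorRep σ (dualRep ρ)

variable (k L) in
/-- The twisted duality functor on maps: `f^♯ = id_L ⊗ f^∨`. -/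
def sharpMap (f : X →ₗ[k] Y) : L ⊗[k] Module.Dual k Y →ₗ[k] L ⊗[k] Module.Dual k X :=
  f.dualMap.lTensor L

variable (k L X) in
/-- The unit of the adjunction `L^∨ ⊗ (-) ⊣ L ⊗ (-)`:
`η_X : X → L ⊗ (L^∨ ⊗ X)`, `x ↦ ∑ ℓᵢ ⊗ (ℓᵢ^∨ ⊗ x)`. -/
def eta [FiniteDimensional k L] : X →ₗ[k] L ⊗[k] (Module.Dual k L ⊗[k] X) :=
  (TensorProduct.assoc k L (Module.Dual k L) X).toLinearMap ∘ₗ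
    TensorProduct.mk k (L ⊗[k] Module.Dual k L) X (coevaluation k L 1)

variable (k L X) in
/-- The map `ξ_X : L^∨ ⊗ X^∨ → (L ⊗ X)^∨`, `ξ_X(λ ⊗ f)(ℓ ⊗ x) = λ(ℓ) f(x)`. -/
def xi : Module.Dual k L ⊗[k] Module.Dual k X →ₗ[k] Module.Dual k (L ⊗[k] X) :=
  TensorProduct.dualDistrib k L X

variable (k L X) in
/-- The pivotal morphism `ω_X : X → X^♯♯` of the twisted duality: the composite
`X → L ⊗ (L^∨ ⊗ X) → L ⊗ (L^∨ ⊗ X^∨∨) → L ⊗ (L ⊗ X^∨)^∨` of `η_X`, the map induced by the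
canonical `X → X^∨∨`, and the map induced by `ξ_{X^∨}`. -/
def omega [FiniteDimensional k L] : X →ₗ[k] L ⊗[k] Module.Dual k (L ⊗[k] Module.Dual k X) :=
  (xi k L (Module.Dual k X)).lTensor L ∘ₗ
    ((Module.Dual.eval k X).lTensor (Module.Dual k L)).lTensor L ∘ₗ eta k L X

lemma eta_mem [FiniteDimensional k L] (σ : H →ₐ[k] Module.End k L) (ρ : H →ₐ[k] Module.End k X) :
    eta k L X ∈ homH ρ (tensorRep σ (tensorRep (dualRep σ) ρ)) := by
  intro h x
  have := assoc_mem σ (dualRep σ) ρ h (coevaluation k L 1 ⊗ₜ[k] x)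
  simp only [eta, LinearMap.comp_apply, TensorProduct.mk_apply]
  rw [← this]
  congr 1
  rw [tensorRep_repr _ _ (ℛ k h)]
  simp only [LinearMap.sum_apply, TensorProduct.map_tmul, tensorRep_coevaluation,
    TensorProduct.smul_tmul]
  rw [← TensorProduct.tmul_sum]
  congr 1
  conv_lhs => rw [← sum_counit_smul (ℛ k h)]
  simp

lemma xi_mem {σ : H →ₐ[k] Module.End k L} (hσ : IsFlippable σ) (ρ : H →ₐ[k] Module.End k X) :
    xi k L X ∈ homH (tensorRep (dualRep σ) (dualRep ρ)) (dualRep (tensorRep σ ρ)) := by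
  intro h t
  induction t with
  | zero => simp
  | add x y hx hy => simp only [map_add, hx, hy]
  | tmul φ f =>
    ext l x
    let B : H ⊗[k] H →ₗ[k] k := LinearMap.mul' k k ∘ₗ
      TensorProduct.map (φ ∘ₗ σ.toLinearMap.flip l) (f ∘ₗ ρ.toLinearMap.flip x)
    have hB : ∀ g : H, B (comul g) = B (TensorProduct.comm k H H (comul g)) := by
      intro g
      have hBf : ∀ s, B s = (LinearMap.mul' k k ∘ₗ TensorProduct.map φ
          (f ∘ₗ ρ.toLinearMap.flip x)) ((σ.toLinearMap.flip l).rTensor H s) := by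
        intro s
        induction s with
        | zero => simp
        | add x y hx hy => simp only [map_add, hx, hy]
        | tmul x y => simp [B]
      rw [hBf, hBf, hσ g l]
    have hS := comul_antipode (k := k) h
    have lhs : (xi k L X) (tensorRep (dualRep σ) (dualRep ρ) h (φ ⊗ₜ[k] f)) (l ⊗ₜ[k] x) =
        B (TensorProduct.map (antipode k) (antipode k) (comul h)) := by
      rw [tensorRep_repr _ _ (ℛ k h), ← (ℛ k h).eq]
      simp [xi, B, dualRep_apply]
    have rhs : (dualRep (tensorRep σ ρ) h (xi k L X (φ ⊗ₜ[k] f))) (l ⊗ₜ[k] x) =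
        B (comul (antipode k h)) := by
      rw [dualRep_apply, tensorRep_repr _ _ (ℛ k (antipode k h)),
        ← (ℛ k (antipode k h)).eq]
      simp [xi, B]
    simp only [TensorProduct.AlgebraTensorModule.curry_apply, TensorProduct.curry_apply,
      LinearMap.restrictScalars_apply]
    rw [lhs, rhs, hB, hS]
    congr 1
    have : ∀ s : H ⊗[k] H, TensorProduct.map (antipode k) (antipode k) s =
        TensorProduct.comm k H H (TensorProduct.map (antipode k) (antipode k)
          (TensorProduct.comm k H H s)) := by
      intro s
      induction s with
      | zero => simp
      | add x y hx hy => simp only [map_add, ← hx, ← hy]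
      | tmul x y => simp
    exact this _

lemma omega_mem [FiniteDimensional k L] (hS : IsInvolutory k H) {σ : H →ₐ[k] Module.End k L} (hσ : IsFlippable σ)
    (ρ : H →ₐ[k] Module.End k X) : omega k L X ∈ homH ρ (sharpRep σ (sharpRep σ ρ)) :=
  comp_mem (comp_mem (eta_mem σ ρ) (lTensor_mem (lTensor_mem (eval_mem hS ρ))))
    (lTensor_mem (xi_mem hσ (dualRep ρ)))

lemma sharpMap_mem (σ : H →ₐ[k] Module.End k L) {ρ : H →ₐ[k] Module.End k X}
    {τ : H →ₐ[k] Module.End k Y} {f : X →ₗ[k] Y} (hf : f ∈ homH ρ τ) :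
    sharpMap k L f ∈ homH (sharpRep σ τ) (sharpRep σ ρ) :=
  lTensor_mem (dualMap_mem hf)

/-- The transposition map `Hom_H(X, Y^♯) → Hom_H(Y, X^♯)`, `f ↦ f^♯ ∘ ω_Y`, of the twisted
duality. -/
def transposition [FiniteDimensional k L] (hS : IsInvolutory k H) {σ : H →ₐ[k] Module.End k L} (hσ : IsFlippable σ)
    (ρ : H →ₐ[k] Module.End k X) (τ : H →ₐ[k] Module.End k Y) :
    homH ρ (sharpRep σ τ) →ₗ[k] homH τ (sharpRep σ ρ) where
  toFun f := ⟨sharpMap k L f.1 ∘ₗ omega k L Y,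
    comp_mem (omega_mem hS hσ τ) (sharpMap_mem σ f.2)⟩
  map_add' f g := by
    ext1
    exact (congrArg (fun u => u ∘ₗ omega k L Y)
      (((LinearMap.lTensorHom L) ∘ₗ Module.Dual.transpose).map_add f.1 g.1)).trans
        (LinearMap.add_comp _ _ _)
  map_smul' c f := by
    ext1
    exact (congrArg (fun u => u ∘ₗ omega k L Y)
      (((LinearMap.lTensorHom L) ∘ₗ Module.Dual.transpose).map_smul c f.1)).trans
        (LinearMap.smul_comp _ _ _)

/-- The twisted Frobenius-Schur indicator `ν(V; L)`: the trace of the transposition map on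
`Hom_H(V, V^♯)`, where `V^♯ = L ⊗ V^∨`. -/
def indicator [FiniteDimensional k L] (hS : IsInvolutory k H) {σ : H →ₐ[k] Module.End k L} (hσ : IsFlippable σ)
    (ρ : H →ₐ[k] Module.End k X) : k :=
  LinearMap.trace k (homH ρ (sharpRep σ ρ)) (transposition hS hσ ρ ρ)

end Twisted

end HopfRep

end

/-!
The proof has two parts: the Larson–Radford theorem `S² = id`, and the Frobenius–Schur argument.

**`S² = id`.** Semisimplicity splits off `ker ε` and gives the Haar integral `Λ`
(`existsUnique_isHaarIntegral`). The functional `λ(h) = Tr(L_h S²)`, where `L_h` is left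
multiplication by `h`, is a left integral in the dual with `λ(Λ) = 1`
(`isLeftIntegral_twistedTrace`, `twistedTrace_haar`). Then `h = λ(Λ₍₂₎ S(h)) Λ₍₁₎`, so `S` is
bijective, `λ` is a Frobenius form with `λ(a b) = λ(b S²(a))` (`integral_mul_comm`), and
`S⁴(b) = g⁻¹ b g` for a grouplike element `g` (`mul_leftSlice_eq`). In particular `S²` has finite
order. Comparing `λ` with the trace form of the semisimple algebra `H` shows that `S²` is inner,
say `S²(b) = w⁻¹ b w`.

On a matrix block of `H` the trace of `S²` is `Tr(wᵢ⁻¹) Tr(wᵢ)`. As `wᵢ` is of finite order up to a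
scalar, this is of the form `|z|²` for a sum `z` of roots of unity. Hence `Tr(S²) = λ(1)` can vanish
only if all `Tr(wᵢ)` do, and then `λ = 0`, which is absurd (`twistedTrace_one_ne_zero`). From
`λ(1) ≠ 0` one gets `g = 1` and `S⁴ = id`. Finally let `x ∈ H` be the character of the regular
representation of the dual and `n = dim H`. Then `x² = n x`, `S²(x) = x` and `λ(x) = λ(1)`, so
`Tr(S²) / n` is the trace of `L_{x/n} S²`, whose cube is itself; it is an integer. A nonzero integer
multiple of `n` is the trace of an involution in dimension `n` only if the involution is `± 1`,
and `S²(1) = 1` (`isInvolutory_of_isSemisimpleRing`).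

**The indicator.** An `H`-linear map `V → L ⊗ V^∨` is an invariant bilinear form on `V`
(`mem_homH_sharp_iff_isInvariantForm`), and `f ↦ f^♯ ∘ ω_V` exchanges the arguments of the form
(`formEquiv_transposition`). So `ν(V; L)` is the trace of the flip on the space of invariant forms.
The element `z = α(S(Λ₍₁₎)) Λ₍₂₎` projects `(V ⊗ V)^∨` to this space, which gives the formula
(`indicator_eq_indicatorFunctional`). For simple `V` the space is at most one-dimensional by
Schur's lemma, as `V` and `L ⊗ V^∨` have the same dimension, and the flip is an involution of it.
-/

open scoped TensorProduct

noncomputable section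

namespace HopfRep

open Coalgebra HopfAlgebra WithConv

/-! ### Sweedler identities and coregular actions -/

section Slices

variable {k H : Type*} [Field k] [Ring H] [HopfAlgebra k H]

lemma toConv_comp_antipode_mul_toConv {A : Type*} [Ring A] [Algebra k A] (φ : H →ₐ[k] A) :
    toConv (φ.toLinearMap ∘ₗ antipode k) * toConv φ.toLinearMap = 1 := by
  ext x
  rw [(ℛ k x).convMul_apply]
  simp only [LinearMap.comp_apply, AlgHom.toLinearMap_apply, ← map_mul, ← map_sum,
    sum_antipode_mul_eq_algebraMap_counit]
  simp

lemma toConv_mul_toConv_comp_antipode {A : Type*} [Ring A] [Algebra k A] (φ : H →ₐ[k] A) :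
    toConv φ.toLinearMap * toConv (φ.toLinearMap ∘ₗ antipode k) = 1 := by
  ext x
  rw [(ℛ k x).convMul_apply]
  simp only [LinearMap.comp_apply, AlgHom.toLinearMap_apply, ← map_mul, ← map_sum,
    sum_mul_antipode_eq_algebraMap_counit]
  simp

/-- In the convolution algebra `Hom(H, H ⊗ H)`, the comultiplication is the product of
`h ↦ h ⊗ 1` and `h ↦ 1 ⊗ h`. The Sweedler identities below are read off from this. -/
lemma toConv_comul_eq_mul : toConv (comul (R := k) (A := H)) =
    toConv (Algebra.TensorProduct.includeLeft (R := k) (S := k) (A := H) (B := H)).toLinearMap *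
      toConv (Algebra.TensorProduct.includeRight (R := k) (A := H) (B := H)).toLinearMap := by
  ext x
  rw [(ℛ k x).convMul_apply]
  simp [(ℛ k x).eq]

/-- The identity `S(h₍₁₎) h₍₂₎ ⊗ h₍₃₎ = 1 ⊗ h`. -/
lemma sum_antipode_tmul_mul_comul {ι : Type*} {h : H} (r : Repr k h ι) :
    ∑ i ∈ r.index, (antipode k (r.left i) ⊗ₜ[k] (1 : H)) * comul (R := k) (r.right i) =
      1 ⊗ₜ[k] h := by
  have e : toConv ((Algebra.TensorProduct.includeLeft (R := k) (S := k) (A := H)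
      (B := H)).toLinearMap ∘ₗ antipode k) * toConv (comul (R := k) (A := H)) =
      toConv (Algebra.TensorProduct.includeRight (R := k) (A := H) (B := H)).toLinearMap := by
    rw [toConv_comul_eq_mul, ← mul_assoc, toConv_comp_antipode_mul_toConv, one_mul]
  have := congr($(e) h)
  rwa [r.convMul_apply] at this

/-- The identity `h₍₁₎ ⊗ h₍₂₎ S(h₍₃₎) = h ⊗ 1`. -/
lemma sum_comul_mul_tmul_antipode {ι : Type*} {h : H} (r : Repr k h ι) :
    ∑ i ∈ r.index, comul (R := k) (r.left i) * ((1 : H) ⊗ₜ[k] antipode k (r.right i)) =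
      h ⊗ₜ[k] 1 := by
  have e : toConv (comul (R := k) (A := H)) *
      toConv ((Algebra.TensorProduct.includeRight (R := k) (A := H) (B := H)).toLinearMap ∘ₗ
        antipode k) = toConv (Algebra.TensorProduct.includeLeft (R := k) (S := k) (A := H)
          (B := H)).toLinearMap := by
    rw [toConv_comul_eq_mul, mul_assoc, toConv_mul_toConv_comp_antipode, mul_one]
  have := congr($(e) h)
  rwa [r.convMul_apply] at this

/-- The identity `h₍₁₎ ⊗ S(h₍₂₎) h₍₃₎ = h ⊗ 1`. -/
lemma sum_lTensor_antipode_comul_mul {ι : Type*} {h : H} (r : Repr k h ι) :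
    ∑ i ∈ r.index, (antipode k).lTensor H (comul (R := k) (r.left i)) *
      ((1 : H) ⊗ₜ[k] r.right i) = h ⊗ₜ[k] 1 := by
  let i₁ : H →ₐ[k] H ⊗[k] H := Algebra.TensorProduct.includeLeft
  let i₂ : H →ₐ[k] H ⊗[k] H := Algebra.TensorProduct.includeRight
  have e : toConv ((antipode k).lTensor H ∘ₗ comul) =
      toConv i₁.toLinearMap * toConv (i₂.toLinearMap ∘ₗ antipode k) := by
    ext x
    rw [(ℛ k x).convMul_apply]
    simp [i₁, i₂, ← (ℛ k x).eq]
  have e' : toConv ((antipode k).lTensor H ∘ₗ comul) * toConv i₂.toLinearMap =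
      toConv i₁.toLinearMap := by
    rw [e, mul_assoc, toConv_comp_antipode_mul_toConv, mul_one]
  have := congr($(e') h)
  rwa [r.convMul_apply] at this

/-- The identity `S(h₍₃₎) ⊗ h₍₁₎ S(h₍₂₎) = S(h) ⊗ 1`. -/
lemma sum_tmul_mul_comul_antipode {ι : Type*} {h : H} (r : Repr k h ι) :
    ∑ i ∈ r.index, ((1 : H) ⊗ₜ[k] r.left i) * comul (R := k) (antipode k (r.right i)) =
      antipode k h ⊗ₜ[k] 1 := by
  let i₁ : H →ₐ[k] H ⊗[k] H := Algebra.TensorProduct.includeLeft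
  let i₂ : H →ₐ[k] H ⊗[k] H := Algebra.TensorProduct.includeRight
  have e : toConv (comul (R := k) (A := H) ∘ₗ antipode k) =
      toConv (i₂.toLinearMap ∘ₗ antipode k) * toConv (i₁.toLinearMap ∘ₗ antipode k) := by
    ext x
    rw [(ℛ k x).convMul_apply]
    simp only [LinearMap.comp_apply]
    rw [comul_antipode]
    simp [i₁, i₂, ← (ℛ k x).eq]
  have e' : toConv i₂.toLinearMap * toConv (comul (R := k) (A := H) ∘ₗ antipode k) =
      toConv (i₁.toLinearMap ∘ₗ antipode k) := by
    rw [e, ← mul_assoc, toConv_mul_toConv_comp_antipode, one_mul]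
  have := congr($(e') h)
  rwa [r.convMul_apply] at this

/-- The identity `S²(h₍₂₎) S(h₍₁₎) ⊗ S²(h₍₃₎) = 1 ⊗ S²(h)`. -/
lemma sum_comul_antipode_antipode_mul {ι : Type*} {h : H} (r : Repr k h ι) :
    ∑ i ∈ r.index, comul (R := k) (antipode k (antipode k (r.right i))) *
      (antipode k (r.left i) ⊗ₜ[k] (1 : H)) = 1 ⊗ₜ[k] antipode k (antipode k h) := by
  -- `Θ(a ⊗ b) = S(b) ⊗ S(a)` is an antimultiplicative map with `Θ(Δ(x)) = Δ(S(x))`.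
  let Θ : H ⊗[k] H →ₗ[k] H ⊗[k] H := TensorProduct.map (antipode k) (antipode k) ∘ₗ
    (TensorProduct.comm k H H).toLinearMap
  have hΘ : ∀ s t : H ⊗[k] H, Θ (s * t) = Θ t * Θ s := by
    intro s t
    induction s with
    | zero => simp
    | add x y hx hy => simp only [add_mul, mul_add, map_add, hx, hy]
    | tmul a b =>
      induction t with
      | zero => simp
      | add x y hx hy => simp only [add_mul, mul_add, map_add, hx, hy]
      | tmul c d => simp [Θ, antipode_mul_antidistrib]
  have hΔ : ∀ x : H, Θ (comul (R := k) x) = comul (antipode k x) := fun x =>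
    (comul_antipode x).symm
  have := congrArg Θ (sum_tmul_mul_comul_antipode r)
  simpa [hΘ, hΔ, Θ, antipode_one] using this

/-- The contraction `a ⊗ b ↦ p(a) b` of the first tensor factor. -/
def evalLeft (p : H →ₗ[k] k) : H ⊗[k] H →ₗ[k] H :=
  (TensorProduct.lid k H).toLinearMap ∘ₗ p.rTensor H

/-- The contraction `a ⊗ b ↦ p(b) a` of the second tensor factor. -/
def evalRight (p : H →ₗ[k] k) : H ⊗[k] H →ₗ[k] H :=
  (TensorProduct.rid k H).toLinearMap ∘ₗ p.lTensor H

@[simp] lemma evalLeft_tmul (p : H →ₗ[k] k) (a b : H) :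
    evalLeft p (a ⊗ₜ[k] b) = p a • b := by simp [evalLeft]

@[simp] lemma evalRight_tmul (p : H →ₗ[k] k) (a b : H) :
    evalRight p (a ⊗ₜ[k] b) = p b • a := by simp [evalRight]

/-- The coregular action `x ↦ p(x₍₁₎) x₍₂₎` of a functional `p`. -/
def leftSlice (p : H →ₗ[k] k) : H →ₗ[k] H := evalLeft p ∘ₗ comul

/-- The coregular action `x ↦ p(x₍₂₎) x₍₁₎` of a functional `p`. -/
def rightSlice (p : H →ₗ[k] k) : H →ₗ[k] H := evalRight p ∘ₗ comul

lemma leftSlice_repr {ι : Type*} (p : H →ₗ[k] k) {h : H} (r : Repr k h ι) :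
    leftSlice p h = ∑ i ∈ r.index, p (r.left i) • r.right i := by
  simp [leftSlice, ← r.eq]

lemma rightSlice_repr {ι : Type*} (p : H →ₗ[k] k) {h : H} (r : Repr k h ι) :
    rightSlice p h = ∑ i ∈ r.index, p (r.right i) • r.left i := by
  simp [rightSlice, ← r.eq]

lemma apply_evalLeft (p q : H →ₗ[k] k) (t : H ⊗[k] H) :
    q (evalLeft p t) = p (evalRight q t) := by
  induction t with
  | zero => simp
  | add x y hx hy => simp only [map_add, hx, hy]
  | tmul a b => simp [mul_comm]

lemma apply_leftSlice (p q : H →ₗ[k] k) (h : H) :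
    q (leftSlice p h) = p (rightSlice q h) := apply_evalLeft p q _

lemma evalLeft_mul (p : H →ₗ[k] k) (t : H ⊗[k] H) (s y : H) :
    evalLeft p (t * (s ⊗ₜ[k] y)) = evalLeft (p ∘ₗ LinearMap.mulRight k s) t * y := by
  induction t with
  | zero => simp
  | add x y hx hy => simp only [map_add, add_mul, hx, hy]
  | tmul a b => simp

lemma evalRight_mul (p : H →ₗ[k] k) (t : H ⊗[k] H) (s y : H) :
    evalRight p (t * (s ⊗ₜ[k] y)) = evalRight (p ∘ₗ LinearMap.mulRight k y) t * s := by
  induction t with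
  | zero => simp
  | add x y hx hy => simp only [map_add, add_mul, hx, hy]
  | tmul a b => simp

lemma evalRight_tmul_mul (p : H →ₗ[k] k) (t : H ⊗[k] H) (s y : H) :
    evalRight p ((s ⊗ₜ[k] y) * t) = s * evalRight (p ∘ₗ LinearMap.mulLeft k y) t := by
  induction t with
  | zero => simp
  | add x y hx hy => simp only [map_add, mul_add, hx, hy]
  | tmul a b => simp

@[simp] lemma leftSlice_counit : leftSlice (counit (R := k) (A := H)) = LinearMap.id := by
  ext h; simp [leftSlice, evalLeft]

@[simp] lemma rightSlice_counit : rightSlice (counit (R := k) (A := H)) = LinearMap.id := by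
  ext h; simp [rightSlice, evalRight]

/-- Both sides are `p(h₍₁₎) h₍₂₎ ⊗ h₍₃₎`. -/
lemma comul_leftSlice (p : H →ₗ[k] k) (h : H) :
    comul (R := k) (leftSlice p h) = (leftSlice p).rTensor H (comul h) := by
  have h1 : ∀ t : H ⊗[k] H, comul (R := k) (evalLeft p t) =
      TensorProduct.lid k (H ⊗[k] H) (p.rTensor (H ⊗[k] H) (comul.lTensor H t)) := by
    intro t
    induction t with
    | zero => simp
    | add x y hx hy => simp only [map_add, hx, hy]
    | tmul a b => simp
  have h2 : ∀ t : (H ⊗[k] H) ⊗[k] H, TensorProduct.lid k (H ⊗[k] H)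
      (p.rTensor (H ⊗[k] H) (TensorProduct.assoc k H H H t)) = (evalLeft p).rTensor H t := by
    intro t
    induction t with
    | zero => simp
    | add x y hx hy => simp only [map_add, hx, hy]
    | tmul a b =>
      induction a with
      | zero => simp
      | add x y hx hy => simp only [map_add, TensorProduct.add_tmul, hx, hy]
      | tmul a c => simp [TensorProduct.smul_tmul']
  rw [leftSlice, LinearMap.comp_apply, h1, ← coassoc_apply, h2, LinearMap.rTensor_comp,
    LinearMap.comp_apply]

/-- Both sides are `p(h₍₃₎) h₍₁₎ ⊗ h₍₂₎`. -/
lemma comul_rightSlice (p : H →ₗ[k] k) (h : H) :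
    comul (R := k) (rightSlice p h) = (rightSlice p).lTensor H (comul h) := by
  have h1 : ∀ t : H ⊗[k] H, comul (R := k) (evalRight p t) =
      TensorProduct.rid k (H ⊗[k] H) (p.lTensor (H ⊗[k] H) (comul.rTensor H t)) := by
    intro t
    induction t with
    | zero => simp
    | add x y hx hy => simp only [map_add, hx, hy]
    | tmul a b => simp
  have h2 : ∀ t : H ⊗[k] (H ⊗[k] H), TensorProduct.rid k (H ⊗[k] H)
      (p.lTensor (H ⊗[k] H) ((TensorProduct.assoc k H H H).symm t)) =
        (evalRight p).lTensor H t := by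
    intro t
    induction t with
    | zero => simp
    | add x y hx hy => simp only [map_add, hx, hy]
    | tmul b a =>
      induction a with
      | zero => simp
      | add x y hx hy => simp only [map_add, TensorProduct.tmul_add, hx, hy]
      | tmul a c => simp [TensorProduct.tmul_smul]
  rw [rightSlice, LinearMap.comp_apply, h1, ← coassoc_symm_apply, h2, LinearMap.lTensor_comp,
    LinearMap.comp_apply]

lemma leftSlice_comp (p q : H →ₗ[k] k) (h : H) :
    leftSlice q (leftSlice p h) = leftSlice (p ∘ₗ rightSlice q) h := by
  change evalLeft q (comul (leftSlice p h)) = evalLeft (p ∘ₗ rightSlice q) (comul h)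
  rw [comul_leftSlice]
  have h2 : ∀ t : H ⊗[k] H, evalLeft q ((leftSlice p).rTensor H t) =
      evalLeft (p ∘ₗ rightSlice q) t := by
    intro t
    induction t with
    | zero => simp
    | add x y hx hy => simp only [map_add, hx, hy]
    | tmul a b => simp [apply_leftSlice]
  exact h2 _

lemma rightSlice_comp (p q : H →ₗ[k] k) (h : H) :
    rightSlice q (rightSlice p h) = rightSlice (q ∘ₗ rightSlice p) h := by
  change evalRight q (comul (rightSlice p h)) = evalRight (q ∘ₗ rightSlice p) (comul h)
  rw [comul_rightSlice, evalRight, evalRight, LinearMap.lTensor_comp]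
  rfl

lemma antipode_rightSlice (p : H →ₗ[k] k) (h : H) :
    antipode k (rightSlice (p ∘ₗ antipode k) h) = leftSlice p (antipode k h) := by
  change _ = evalLeft p (comul (antipode k h))
  rw [comul_antipode, rightSlice_repr _ (ℛ k h), ← (ℛ k h).eq]
  simp

lemma antipode_leftSlice (p : H →ₗ[k] k) (h : H) :
    antipode k (leftSlice (p ∘ₗ antipode k) h) = rightSlice p (antipode k h) := by
  change _ = evalRight p (comul (antipode k h))
  rw [comul_antipode, leftSlice_repr _ (ℛ k h), ← (ℛ k h).eq]
  simp

lemma sum_coord_smul_apply_mul {A ι : Type*} [Ring A] [Algebra k A] [Fintype ι]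
    (b : Module.Basis ι k A) (p : A →ₗ[k] k) (a s : A) :
    ∑ i, b.coord i s • p (a * b i) = p (a * s) := by
  simpa only [Finset.mul_sum, map_sum, mul_smul_comm, map_smul, Module.Basis.coord_apply] using
    congrArg (fun t => p (a * t)) (b.sum_repr s)

end Slices

/-! ### Haar integrals and the trace integral -/

section Haar

variable {k H : Type*} [Field k] [Ring H] [HopfAlgebra k H]

lemma eq_of_left_right_integral {Λ Λ' : H} (h1 : ∀ h : H, h * Λ = counit (R := k) h • Λ)
    (e1 : counit (R := k) Λ = 1) (h2 : ∀ h : H, Λ' * h = counit (R := k) h • Λ')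
    (e2 : counit (R := k) Λ' = 1) : Λ = Λ' := by
  have a := h1 Λ'
  have b := h2 Λ
  rw [e2, one_smul] at a
  rw [e1, one_smul] at b
  exact a.symm.trans b

/-- A left integral spans a complement of the left ideal `ker ε`, which exists by
semisimplicity. -/
lemma exists_left_integral [IsSemisimpleRing H] :
    ∃ Λ : H, (∀ h : H, h * Λ = counit (R := k) h • Λ) ∧ counit (R := k) Λ = 1 := by
  let K : Submodule H H := RingHom.ker (Bialgebra.counitAlgHom k H)
  have hK : ∀ x : H, x ∈ K ↔ counit (R := k) x = 0 := fun x => Iff.rfl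
  obtain ⟨I, hI⟩ := exists_isCompl K
  obtain ⟨e, he, f, hf, hef⟩ := Submodule.mem_sup.1
    (show (1 : H) ∈ K ⊔ I by rw [hI.sup_eq_top]; trivial)
  have hf1 : counit (R := k) f = 1 := by
    have := congrArg (counit (R := k)) hef
    rw [map_add, (hK e).1 he, zero_add] at this
    simpa using this
  refine ⟨f, fun h => ?_, hf1⟩
  have hI' : (h - algebraMap k H (counit h)) * f ∈ I := I.smul_mem _ hf
  have hK' : (h - algebraMap k H (counit h)) * f ∈ K := by
    rw [hK, Bialgebra.counit_mul, map_sub, Bialgebra.counit_algebraMap, sub_self, zero_mul]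
  have h0 : (h - algebraMap k H (counit h)) * f ∈ K ⊓ I := ⟨hK', hI'⟩
  rw [hI.inf_eq_bot, Submodule.mem_bot, sub_mul, sub_eq_zero] at h0
  rw [h0, Algebra.smul_def]

/-- The mirror image of `exists_left_integral`, over the opposite ring, which is again semisimple.
-/
lemma exists_right_integral [IsSemisimpleRing H] :
    ∃ Λ : H, (∀ h : H, Λ * h = counit (R := k) h • Λ) ∧ counit (R := k) Λ = 1 := by
  let ε : Hᵐᵒᵖ →ₗ[k] k := counit (R := k) ∘ₗ (MulOpposite.opLinearEquiv k).symm.toLinearMap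
  let K : Submodule Hᵐᵒᵖ Hᵐᵒᵖ :=
    { carrier := {x | ε x = 0}
      add_mem' := fun {a b} ha hb => by
        simp only [Set.mem_ofPred_eq] at *
        rw [map_add, ha, hb, add_zero]
      zero_mem' := map_zero ε
      smul_mem' := fun c x hx => by
        simp only [Set.mem_ofPred_eq] at *
        simp only [ε, LinearMap.comp_apply, LinearEquiv.coe_coe] at hx ⊢
        simpa using Or.inl hx }
  have hK : ∀ x : Hᵐᵒᵖ, x ∈ K ↔ counit (R := k) x.unop = 0 := fun x => Iff.rfl
  obtain ⟨I, hI⟩ := exists_isCompl K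
  obtain ⟨e, he, f, hf, hef⟩ := Submodule.mem_sup.1
    (show (1 : Hᵐᵒᵖ) ∈ K ⊔ I by rw [hI.sup_eq_top]; trivial)
  have hf1 : counit (R := k) f.unop = 1 := by
    have := congrArg (fun x => counit (R := k) x.unop) hef
    simp only [MulOpposite.unop_add, map_add, (hK e).1 he, zero_add] at this
    simpa using this
  refine ⟨f.unop, fun h => ?_, hf1⟩
  have hI' : MulOpposite.op (h - algebraMap k H (counit h)) * f ∈ I := I.smul_mem _ hf
  have hK' : MulOpposite.op (h - algebraMap k H (counit h)) * f ∈ K := by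
    rw [hK, MulOpposite.unop_mul, Bialgebra.counit_mul, MulOpposite.unop_op, map_sub,
      Bialgebra.counit_algebraMap, sub_self, mul_zero]
  have h0 : MulOpposite.op (h - algebraMap k H (counit h)) * f ∈ K ⊓ I := ⟨hK', hI'⟩
  rw [hI.inf_eq_bot, Submodule.mem_bot] at h0
  have h1 := congrArg MulOpposite.unop h0
  rw [MulOpposite.unop_mul, MulOpposite.unop_op, mul_sub, MulOpposite.unop_zero, sub_eq_zero] at h1
  rw [h1, Algebra.smul_def, Algebra.commutes]

variable (k H) in
/-- A semisimple Hopf algebra has a unique Haar integral. -/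
theorem existsUnique_isHaarIntegral [IsSemisimpleRing H] : ∃! Λ : H, IsHaarIntegral k Λ := by
  obtain ⟨Λ, h1, e1⟩ := exists_left_integral (k := k) (H := H)
  obtain ⟨Λ', h2, e2⟩ := exists_right_integral (k := k) (H := H)
  have := eq_of_left_right_integral h1 e1 h2 e2
  subst this
  exact ⟨Λ, ⟨h1, h2, e1⟩, fun Λ' h => (eq_of_left_right_integral h1 e1 h.2.1 h.2.2).symm⟩

/-- The identity `Λ₍₁₎ ⊗ h Λ₍₂₎ = S(h) Λ₍₁₎ ⊗ Λ₍₂₎`. -/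
lemma IsHaarIntegral.tmul_mul_comul {Λ : H} (hΛ : IsHaarIntegral k Λ) (h : H) :
    ((1 : H) ⊗ₜ[k] h) * comul (R := k) Λ = (antipode k h ⊗ₜ[k] 1) * comul (R := k) Λ := by
  rw [← sum_antipode_tmul_mul_comul (ℛ k h), Finset.sum_mul]
  simp only [mul_assoc, ← Bialgebra.comul_mul, hΛ.1, map_smul, mul_smul_comm]
  have e : antipode k h = ∑ i ∈ (ℛ k h).index,
      counit (R := k) ((ℛ k h).right i) • antipode k ((ℛ k h).left i) := by
    conv_lhs => rw [← LinearMap.id_apply (R := k) h, ← rightSlice_counit, rightSlice_repr _ (ℛ k h)]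
    simp
  rw [e]
  simp [TensorProduct.sum_tmul, Finset.sum_mul, ← TensorProduct.smul_tmul']

/-- The identity `Λ₍₁₎ h ⊗ Λ₍₂₎ = Λ₍₁₎ ⊗ Λ₍₂₎ S(h)`. -/
lemma IsHaarIntegral.comul_mul_tmul {Λ : H} (hΛ : IsHaarIntegral k Λ) (h : H) :
    comul (R := k) Λ * (h ⊗ₜ[k] (1 : H)) = comul (R := k) Λ * (1 ⊗ₜ[k] antipode k h) := by
  rw [← sum_comul_mul_tmul_antipode (ℛ k h), Finset.mul_sum]
  simp only [← mul_assoc, ← Bialgebra.comul_mul, hΛ.2.1, map_smul, smul_mul_assoc]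
  have e : antipode k h = ∑ i ∈ (ℛ k h).index,
      counit (R := k) ((ℛ k h).left i) • antipode k ((ℛ k h).right i) := by
    conv_lhs => rw [← LinearMap.id_apply (R := k) h, ← leftSlice_counit, leftSlice_repr _ (ℛ k h)]
    simp
  rw [e]
  simp [TensorProduct.tmul_sum, Finset.mul_sum]

end Haar

section FrobeniusForm

variable {k H : Type*} [Field k] [Ring H] [HopfAlgebra k H]

/-- The functional `μ` is a left integral in the dual of `H`: `μ(h₍₂₎) h₍₁₎ = μ(h) 1`. -/
def IsLeftIntegral (μ : H →ₗ[k] k) : Prop := ∀ h : H, rightSlice μ h = μ h • (1 : H)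

variable (k H) in
/-- The square of the antipode, an algebra endomorphism. -/
def antipodeSq : H →ₐ[k] H :=
  AlgHom.ofLinearMap (antipode k ∘ₗ antipode k) (by simp [antipode_one])
    (fun x y => by simp [antipode_mul_antidistrib])

lemma antipodeSq_apply (h : H) : antipodeSq k H h = antipode k (antipode k h) := rfl

variable (k H) in
/-- The functional `h ↦ Tr(x ↦ h S²(x))`. -/
def twistedTrace : H →ₗ[k] k :=
  LinearMap.trace k H ∘ₗ LinearMap.lcomp k H (antipodeSq k H).toLinearMap ∘ₗ LinearMap.mul k H

lemma twistedTrace_apply (h : H) : twistedTrace k H h =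
    LinearMap.trace k H (LinearMap.mulLeft k h ∘ₗ (antipodeSq k H).toLinearMap) := rfl

variable [FiniteDimensional k H]

variable (k H) in
/-- The functional `λ(h) = Tr(L_h S²)`, with `L_h` the left multiplication, is a left integral.
Write `R_p` for `leftSlice p`. For a functional `p`, with `p(x y) = ∑ pᵢ(x) eⁱ(y)`, the identity
`S²(x₍₂₎) S(x₍₁₎) = ε(x)` gives `p(h₍₁₎) L_{h₍₂₎} S² = ∑ R_{pᵢ} (L_h S²) R_{eⁱ ∘ S}`. By
cyclicity of the trace this has the same trace as `L_h S² (∑ R_{eⁱ ∘ S} R_{pᵢ}) = p(1) L_h S²`. No invertibility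
of `S` is needed. -/
theorem isLeftIntegral_twistedTrace : IsLeftIntegral (twistedTrace k H) := by
  intro h
  rw [← sub_eq_zero]
  apply (Module.forall_dual_apply_eq_zero_iff k _).1
  intro p
  rw [map_sub, sub_eq_zero, ← apply_leftSlice]
  let b := Module.finBasis k H
  have hexp : ∀ a s : H, ∑ i, b.coord i s • p (a * b i) = p (a * s) :=
    sum_coord_smul_apply_mul b p
  have hb : ∀ (s : H) (t : H ⊗[k] H),
      ∑ i, b.coord i s • evalLeft (p ∘ₗ LinearMap.mulRight k (b i)) t =
        evalLeft p (t * (s ⊗ₜ[k] 1)) := by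
    intro s t
    rw [evalLeft_mul, mul_one]
    induction t with
    | zero => simp
    | add x y hx hy => simp only [map_add, smul_add, Finset.sum_add_distrib, hx, hy]
    | tmul x y =>
      simp only [evalLeft_tmul, LinearMap.comp_apply, LinearMap.mulRight_apply, ← smul_assoc,
        ← Finset.sum_smul, hexp]
  have key : LinearMap.mulLeft k (leftSlice p h) ∘ₗ (antipodeSq k H).toLinearMap =
      ∑ i, leftSlice (p ∘ₗ LinearMap.mulRight k (b i)) ∘ₗ
        (LinearMap.mulLeft k h ∘ₗ (antipodeSq k H).toLinearMap) ∘ₗ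
          leftSlice (b.coord i ∘ₗ antipode k) := by
    ext x
    have e := congrArg (fun t => evalLeft p (comul (R := k) h * t))
      (sum_comul_antipode_antipode_mul (ℛ k x))
    simp only [Finset.mul_sum, map_sum] at e
    simp only [LinearMap.sum_apply, LinearMap.comp_apply, leftSlice_repr _ (ℛ k x), map_sum,
      map_smul, LinearMap.mulLeft_apply, AlgHom.toLinearMap_apply]
    rw [Finset.sum_comm]
    simp only [leftSlice, LinearMap.comp_apply]
    simp only [hb]
    simp only [Bialgebra.comul_mul, antipodeSq_apply, mul_assoc]
    rw [e, evalLeft_mul]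
    congr 2
    ext; simp
  have key2 : ∑ i, leftSlice (b.coord i ∘ₗ antipode k) ∘ₗ
      leftSlice (p ∘ₗ LinearMap.mulRight k (b i)) = p 1 • LinearMap.id := by
    ext x
    simp only [LinearMap.sum_apply, LinearMap.comp_apply, leftSlice_comp]
    have : ∑ i, (p ∘ₗ LinearMap.mulRight k (b i)) ∘ₗ rightSlice (b.coord i ∘ₗ antipode k) =
        p 1 • counit := by
      ext y
      simp only [LinearMap.sum_apply, LinearMap.comp_apply, rightSlice_repr _ (ℛ k y), map_sum,
        map_smul, LinearMap.mulRight_apply]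
      rw [Finset.sum_comm]
      simp only [hexp, ← map_sum, sum_mul_antipode_eq_smul]
      simp [mul_comm]
    have e : ∀ f : Fin (Module.finrank k H) → H →ₗ[k] k,
        ∑ i, leftSlice (f i) x = leftSlice (∑ i, f i) x := by
      intro f
      simp only [leftSlice_repr _ (ℛ k x), LinearMap.sum_apply, Finset.sum_smul]
      rw [Finset.sum_comm]
    rw [e, this, leftSlice_repr _ (ℛ k x)]
    simp [mul_smul, ← Finset.smul_sum, sum_counit_smul]
  rw [twistedTrace_apply, key, map_sum]
  have : ∀ i, LinearMap.trace k H (leftSlice (p ∘ₗ LinearMap.mulRight k (b i)) ∘ₗ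
        (LinearMap.mulLeft k h ∘ₗ (antipodeSq k H).toLinearMap) ∘ₗ
          leftSlice (b.coord i ∘ₗ antipode k)) = LinearMap.trace k H
        ((LinearMap.mulLeft k h ∘ₗ (antipodeSq k H).toLinearMap) ∘ₗ
          leftSlice (b.coord i ∘ₗ antipode k) ∘ₗ
            leftSlice (p ∘ₗ LinearMap.mulRight k (b i))) := by
    intro i
    rw [LinearMap.trace_comp_comm', LinearMap.comp_assoc]
  simp only [this]
  have hsum : ∀ (F : H →ₗ[k] H) (G : Fin (Module.finrank k H) → H →ₗ[k] H),
      ∑ i, F ∘ₗ G i = F ∘ₗ ∑ i, G i := by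
    intro F G
    ext x
    simp
  rw [← map_sum, hsum, key2]
  simp [LinearMap.comp_smul, twistedTrace_apply, mul_comm]

end FrobeniusForm

/-! ### The Frobenius form and Radford's formula -/

section Frobenius

variable {k H : Type*} [Field k] [Ring H] [HopfAlgebra k H]

/-- The operator `x ↦ Λ S²(x) = ε(x) Λ` has trace `ε(Λ) = 1`. -/
lemma twistedTrace_haar [FiniteDimensional k H] {Λ : H} (hΛ : IsHaarIntegral k Λ) :
    twistedTrace k H Λ = 1 := by
  have : LinearMap.mulLeft k Λ ∘ₗ (antipodeSq k H).toLinearMap =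
      (counit (R := k) (A := H)).smulRight Λ := by
    ext x
    simp [antipodeSq_apply, hΛ.2.1]
  rw [twistedTrace_apply, this, LinearMap.trace_smulRight, hΛ.2.2]

lemma antipodeSq_leftSlice (p : H →ₗ[k] k) (h : H) :
    antipodeSq k H (leftSlice (p ∘ₗ (antipodeSq k H).toLinearMap) h) =
      leftSlice p (antipodeSq k H h) := by
  rw [antipodeSq_apply, antipodeSq_apply, ← antipode_rightSlice, ← antipode_leftSlice]
  rfl

/-- The linear map `q ↦ q(Λ₍₂₎) Λ₍₁₎` from the dual of `H` to `H`. -/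
def sliceMap (Λ : H) : (H →ₗ[k] k) →ₗ[k] H where
  toFun q := rightSlice q Λ
  map_add' p q := by simp [rightSlice_repr _ (ℛ k Λ), add_smul, Finset.sum_add_distrib]
  map_smul' c q := by simp [rightSlice_repr _ (ℛ k Λ), Finset.smul_sum, mul_smul]

variable {Λ : H} {μ : H →ₗ[k] k}

/-- The identity `μ(Λ₍₂₎ S(h)) Λ₍₁₎ = h`. -/
lemma sliceMap_mulRight (hΛ : IsHaarIntegral k Λ) (hμ : IsLeftIntegral μ) (h1 : μ Λ = 1)
    (h : H) : sliceMap Λ (μ ∘ₗ LinearMap.mulRight k (antipode k h)) = h := by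
  have := congrArg (evalRight μ) (hΛ.comul_mul_tmul h)
  rw [evalRight_mul, evalRight_mul, mul_one] at this
  refine this.symm.trans ?_
  have e : evalRight μ (comul Λ) = 1 := by
    have := hμ Λ
    rwa [h1, one_smul] at this
  rw [LinearMap.mulRight_one, LinearMap.comp_id, e, one_mul]

/-- The identity `μ(h Λ₍₂₎) Λ₍₁₎ = μ(Λ) S(h)`. -/
lemma sliceMap_mulLeft (hΛ : IsHaarIntegral k Λ) (hμ : IsLeftIntegral μ) (h : H) :
    sliceMap Λ (μ ∘ₗ LinearMap.mulLeft k h) = μ Λ • antipode k h := by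
  have := congrArg (evalRight μ) (hΛ.tmul_mul_comul h)
  rw [evalRight_tmul_mul, evalRight_tmul_mul, one_mul] at this
  refine this.trans ?_
  have e : evalRight μ (comul Λ) = μ Λ • (1 : H) := hμ Λ
  rw [LinearMap.mulLeft_one, LinearMap.comp_id, e, mul_smul_comm, mul_one]

variable [FiniteDimensional k H]

/-- The antipode is injective because `h = μ(Λ₍₂₎ S(h)) Λ₍₁₎` for a left integral `μ` with
`μ(Λ) = 1`. -/
lemma antipode_bijective (hΛ : IsHaarIntegral k Λ) :
    Function.Bijective (antipode k (A := H)) := by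
  have inj : Function.Injective (antipode k (A := H)) := by
    intro x y hxy
    rw [← sliceMap_mulRight hΛ (isLeftIntegral_twistedTrace k H) (twistedTrace_haar hΛ) x, hxy,
      sliceMap_mulRight hΛ (isLeftIntegral_twistedTrace k H) (twistedTrace_haar hΛ) y]
  exact ⟨inj, LinearMap.injective_iff_surjective.1 inj⟩

lemma sliceMap_injective (hΛ : IsHaarIntegral k Λ) :
    Function.Injective (sliceMap (k := k) Λ) := by
  rw [LinearMap.injective_iff_surjective_of_finrank_eq_finrank (Subspace.dual_finrank_eq (K := k))]
  exact fun h => ⟨_,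
    sliceMap_mulRight hΛ (isLeftIntegral_twistedTrace k H) (twistedTrace_haar hΛ) h⟩

/-- The Nakayama automorphism of the Frobenius form `μ` is `S²`. -/
lemma integral_mul_comm (hΛ : IsHaarIntegral k Λ) (hμ : IsLeftIntegral μ) (h1 : μ Λ = 1)
    (a b : H) : μ (a * b) = μ (b * antipodeSq k H a) := by
  have : μ ∘ₗ LinearMap.mulLeft k a = μ ∘ₗ LinearMap.mulRight k (antipodeSq k H a) := by
    apply sliceMap_injective hΛ
    rw [sliceMap_mulLeft hΛ hμ, antipodeSq_apply, sliceMap_mulRight hΛ hμ h1, h1, one_smul]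
  exact congr($(this) b)

lemma eq_zero_of_integral_mul_left (hΛ : IsHaarIntegral k Λ) (hμ : IsLeftIntegral μ)
    (h1 : μ Λ = 1) {h : H} (h0 : ∀ a, μ (h * a) = 0) : h = 0 := by
  apply (antipode_bijective hΛ).1
  rw [map_zero, ← one_smul k (antipode k h), ← h1, ← sliceMap_mulLeft hΛ hμ]
  have : μ ∘ₗ LinearMap.mulLeft k h = 0 := by ext; simp [h0]
  rw [this, map_zero]

lemma eq_zero_of_integral_mul_right (hΛ : IsHaarIntegral k Λ) (hμ : IsLeftIntegral μ)
    (h1 : μ Λ = 1) {h : H} (h0 : ∀ a, μ (a * h) = 0) : h = 0 := by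
  obtain ⟨h, rfl⟩ := (antipode_bijective hΛ).2 h
  rw [← sliceMap_mulRight hΛ hμ h1 h]
  have : μ ∘ₗ LinearMap.mulRight k (antipode k h) = 0 := by ext; simp [h0]
  rw [this, map_zero, map_zero]

/-- Left integrals in the dual are unique up to scalars. -/
lemma IsLeftIntegral.eq_smul (hΛ : IsHaarIntegral k Λ) (hμ : IsLeftIntegral μ) (h1 : μ Λ = 1)
    {ν : H →ₗ[k] k} (hν : IsLeftIntegral ν) : ν = ν Λ • μ := by
  have : ν ∘ₗ LinearMap.mulLeft k (1 : H) = (ν Λ • μ) ∘ₗ LinearMap.mulLeft k (1 : H) := by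
    apply sliceMap_injective hΛ
    rw [sliceMap_mulLeft hΛ hν, LinearMap.smul_comp, map_smul, sliceMap_mulLeft hΛ hμ, h1,
      one_smul]
  simpa using this

/-- The left integral `μ` satisfies `μ(h₍₁₎) h₍₂₎ = μ(h) g`, where `g = μ(Λ₍₁₎) Λ₍₂₎`. -/
lemma leftSlice_integral (hΛ : IsHaarIntegral k Λ) (hμ : IsLeftIntegral μ) (h1 : μ Λ = 1)
    (h : H) : leftSlice μ h = μ h • leftSlice μ Λ := by
  rw [← sub_eq_zero]
  apply (Module.forall_dual_apply_eq_zero_iff k _).1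
  intro p
  have hν : IsLeftIntegral (μ ∘ₗ rightSlice p) := by
    intro x
    rw [← rightSlice_comp, hμ]
    rfl
  have := congr($(hμ.eq_smul hΛ h1 hν) h)
  simp only [LinearMap.comp_apply, LinearMap.smul_apply, smul_eq_mul] at this
  rw [map_sub, sub_eq_zero, map_smul, apply_leftSlice, apply_leftSlice, this, smul_eq_mul,
    mul_comm]

/-- The element `μ(Λ₍₁₎) Λ₍₂₎` is the distinguished grouplike element of `H`. -/
lemma isGroupLikeElem_leftSlice (hΛ : IsHaarIntegral k Λ) (hμ : IsLeftIntegral μ)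
    (h1 : μ Λ = 1) : IsGroupLikeElem k (leftSlice μ Λ) where
  counit_eq_one := by rw [apply_leftSlice]; simp [h1]
  comul_eq_tmul_self := by
    obtain ⟨g, hg⟩ : ∃ g, leftSlice μ Λ = g := ⟨_, rfl⟩
    have e : ∀ h, leftSlice μ h = μ h • g := hg ▸ leftSlice_integral hΛ hμ h1
    rw [comul_leftSlice, ← (ℛ k Λ).eq]
    simp only [map_sum, LinearMap.rTensor_tmul, e]
    simp only [TensorProduct.smul_tmul, ← TensorProduct.tmul_sum, ← leftSlice_repr]
    simp only [e, h1, one_smul]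

lemma antipode_haar (hΛ : IsHaarIntegral k Λ) : antipode k Λ = Λ := by
  apply Eq.symm
  apply eq_of_left_right_integral hΛ.1 hΛ.2.2 _ (by simp [hΛ.2.2])
  intro h
  obtain ⟨h, rfl⟩ := (antipode_bijective hΛ).2 h
  rw [← antipode_mul_antidistrib, hΛ.1]
  simp

/-- Two right integrals in the dual that agree on `Λ` are equal. -/
lemma eq_of_right_integral (hΛ : IsHaarIntegral k Λ) {ν ν' : H →ₗ[k] k}
    (hν : ∀ h : H, leftSlice ν h = ν h • (1 : H)) (hν' : ∀ h : H, leftSlice ν' h = ν' h • (1 : H))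
    (e : ν Λ = ν' Λ) : ν = ν' := by
  have aux : ∀ {ν : H →ₗ[k] k}, (∀ h : H, leftSlice ν h = ν h • (1 : H)) →
      IsLeftIntegral (ν ∘ₗ antipode k) := by
    intro ν hν h
    apply (antipode_bijective hΛ).1
    rw [antipode_rightSlice, hν, map_smul, antipode_one]
    rfl
  have a := (isLeftIntegral_twistedTrace k H).eq_smul hΛ (twistedTrace_haar hΛ) (aux hν)
  have b := (isLeftIntegral_twistedTrace k H).eq_smul hΛ (twistedTrace_haar hΛ) (aux hν')
  simp only [LinearMap.comp_apply, antipode_haar hΛ] at a b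
  ext h
  obtain ⟨h, rfl⟩ := (antipode_bijective hΛ).2 h
  have a' := congr($(a) h)
  have b' := congr($(b) h)
  rw [LinearMap.comp_apply] at a' b'
  rw [a', b', e]

/-- Both `μ ∘ S` and `h ↦ μ(h g)`, for the distinguished grouplike element `g`, are right integrals
with value `1` at `Λ`. -/
lemma integral_antipode (hΛ : IsHaarIntegral k Λ) (hμ : IsLeftIntegral μ) (h1 : μ Λ = 1) (h : H) :
    μ (antipode k h) = μ (h * leftSlice μ Λ) := by
  have hg := isGroupLikeElem_leftSlice hΛ hμ h1
  have : μ ∘ₗ antipode k = μ ∘ₗ LinearMap.mulRight k (leftSlice μ Λ) := by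
    apply eq_of_right_integral hΛ
    · intro x
      apply (antipode_bijective hΛ).1
      rw [antipode_leftSlice, hμ, map_smul, antipode_one]
      rfl
    · intro x
      apply hg.isUnit.mul_right_cancel
      have e := evalLeft_mul μ (comul x) (leftSlice μ Λ) (leftSlice μ Λ)
      rw [← hg.comul_eq_tmul_self, ← Bialgebra.comul_mul] at e
      refine e.symm.trans ((leftSlice_integral hΛ hμ h1 _).trans ?_)
      simp
    · simp [antipode_haar hΛ, hΛ.2.1, hg.counit_eq_one]
  exact congr($(this) h)

/-- Radford's formula `S⁴(b) = g⁻¹ b g`, with `g` the distinguished grouplike element, for a Hopf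
algebra with a Haar integral. It results from computing `μ(S(a b))` in two ways. -/
lemma mul_leftSlice_eq (hΛ : IsHaarIntegral k Λ) (hμ : IsLeftIntegral μ) (h1 : μ Λ = 1) (b : H) :
    b * leftSlice μ Λ = leftSlice μ Λ * antipodeSq k H (antipodeSq k H b) := by
  rw [← sub_eq_zero]
  apply eq_zero_of_integral_mul_right hΛ hμ h1
  intro a
  rw [mul_sub, map_sub, sub_eq_zero, ← mul_assoc, ← mul_assoc, ← integral_antipode hΛ hμ h1,
    antipode_mul_antidistrib, integral_mul_comm hΛ hμ h1, antipodeSq_apply (antipode k b),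
    ← antipodeSq_apply b, ← antipode_mul_antidistrib, integral_antipode hΛ hμ h1, mul_assoc,
    integral_mul_comm hΛ hμ h1]

/-- By Radford's formula, the order of `S²` divides twice the order of the distinguished grouplike
element, which is finite since grouplike elements are linearly independent. -/
lemma exists_antipodeSq_pow_eq_one (hΛ : IsHaarIntegral k Λ) :
    ∃ N : ℕ, 0 < N ∧ (antipodeSq k H) ^ N = 1 := by
  obtain ⟨μ, hμ, h1⟩ : ∃ μ : H →ₗ[k] k, IsLeftIntegral μ ∧ μ Λ = 1 :=
    ⟨_, isLeftIntegral_twistedTrace k H, twistedTrace_haar hΛ⟩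
  have : Finite (GroupLike k H) := (linearIndep_groupLikeVal (R := k) (A := H)).finite
  let g : GroupLike k H := ⟨_, isGroupLikeElem_leftSlice hΛ hμ h1⟩
  have hN : 0 < orderOf g := orderOf_pos g
  have hg : (leftSlice μ Λ) ^ orderOf g = 1 := by
    have := congrArg (GroupLike.val (R := k)) (pow_orderOf_eq_one g)
    rwa [GroupLike.val_pow, GroupLike.val_one] at this
  have hpow : ∀ (m : ℕ) (b : H), b * leftSlice μ Λ ^ m =
      leftSlice μ Λ ^ m * (antipodeSq k H ^ (2 * m)) b := by
    intro m
    induction m with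
    | zero => simp
    | succ m ih =>
      intro b
      rw [pow_succ, ← mul_assoc, ih, mul_assoc, mul_leftSlice_eq hΛ hμ h1, mul_assoc,
        show 2 * (m + 1) = 2 + 2 * m by ring, pow_add (antipodeSq k H), pow_two]
      rfl
  refine ⟨2 * orderOf g, by omega, ?_⟩
  ext b
  have := hpow (orderOf g) b
  rw [hg, mul_one, one_mul] at this
  simpa using this.symm

end Frobenius

/-! ### Traces of inner automorphisms of semisimple algebras -/

section FiniteOrder

variable {k : Type*} [Field k] [IsAlgClosed k] [CharZero k]

/-- An endomorphism of finite order has trace a sum of roots of unity, and its inverse has trace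
the sum of the inverse roots of unity. -/
lemma exists_trace_eq_sum_of_pow_eq_one {V : Type*} [AddCommGroup V] [Module k V]
    [FiniteDimensional k V] {N : ℕ} (hN : 0 < N) {T T' : Module.End k V} (hT : T ^ N = 1)
    (hTT' : T' * T = 1) :
    ∃ (s : Finset k) (m : k → ℕ), (∀ z ∈ s, z ^ N = 1) ∧
      LinearMap.trace k V T = ∑ z ∈ s, (m z : k) * z ∧
      LinearMap.trace k V T' = ∑ z ∈ s, (m z : k) * z⁻¹ := by
  classical
  have hss : T.IsSemisimple := by
    have : (Polynomial.X ^ N - Polynomial.C (1 : k)).Separable :=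
      Polynomial.separable_X_pow_sub_C 1 (by exact_mod_cast hN.ne') one_ne_zero
    apply Module.End.isSemisimple_of_squarefree_aeval_eq_zero this.squarefree
    simp [hT]
  have htop : ⨆ z, T.eigenspace z = ⊤ :=
    hss.iSup_eigenspace_eq_top
  have hint := DirectSum.isInternal_submodule_of_iSupIndep_of_iSup_eq_top
    T.eigenspaces_iSupIndep htop
  have hfin : {z | T.eigenspace z ≠ ⊥}.Finite :=
    WellFoundedGT.finite_ne_bot_of_iSupIndep T.eigenspaces_iSupIndep
  have hroot : ∀ z, T.eigenspace z ≠ ⊥ → z ^ N = 1 := by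
    intro z hz
    obtain ⟨v, hv, hv0⟩ := Submodule.exists_mem_ne_zero_of_ne_bot hz
    have h1 : (T ^ N) v = z ^ N • v := by
      have : ∀ n : ℕ, (T ^ n) v = z ^ n • v := by
        intro n
        induction n with
        | zero => simp
        | succ n ih =>
          rw [pow_succ', Module.End.mul_apply, ih, map_smul, Module.End.mem_eigenspace_iff.1 hv,
            smul_smul, pow_succ]
      exact this N
    rw [hT, Module.End.one_apply] at h1
    have h2 : (z ^ N - 1) • v = 0 := by rw [sub_smul, one_smul, ← h1, sub_self]
    exact sub_eq_zero.1 ((smul_eq_zero.1 h2).resolve_right hv0)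
  have hz0 : ∀ z, T.eigenspace z ≠ ⊥ → z ≠ 0 := by
    rintro z hz rfl
    have := hroot 0 hz
    rw [zero_pow hN.ne'] at this
    exact zero_ne_one this
  have happ' : ∀ z, ∀ v ∈ T.eigenspace z, T' v = z⁻¹ • v := by
    intro z v hv
    by_cases hz : T.eigenspace z = ⊥
    · rw [hz, Submodule.mem_bot] at hv
      simp [hv]
    have : T' (T v) = v := congr($(hTT') v)
    rw [Module.End.mem_eigenspace_iff.1 hv, map_smul] at this
    nth_rw 2 [← this]
    rw [smul_smul, inv_mul_cancel₀ (hz0 z hz), one_smul]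
  have hm : ∀ z, Set.MapsTo T (T.eigenspace z) (T.eigenspace z) := fun z v hv => by
    have hv' : v ∈ T.eigenspace z := hv
    rw [Module.End.mem_eigenspace_iff.1 hv']
    exact Submodule.smul_mem _ _ hv'
  have hm' : ∀ z, Set.MapsTo T' (T.eigenspace z) (T.eigenspace z) := fun z v hv => by
    have hv' : v ∈ T.eigenspace z := hv
    rw [happ' z v hv']
    exact Submodule.smul_mem _ _ hv'
  refine ⟨hfin.toFinset, fun z => Module.finrank k (T.eigenspace z), ?_, ?_, ?_⟩
  · intro z hz
    exact hroot z (hfin.mem_toFinset.1 hz)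
  · rw [LinearMap.trace_eq_sum_trace_restrict' hint hfin hm]
    refine Finset.sum_congr rfl fun z _ => ?_
    have : T.restrict (hm z) = z • LinearMap.id := by
      ext v
      exact Module.End.mem_eigenspace_iff.1 v.2
    rw [this, map_smul, LinearMap.trace_id, smul_eq_mul, mul_comm]
  · rw [LinearMap.trace_eq_sum_trace_restrict' hint hfin hm']
    refine Finset.sum_congr rfl fun z _ => ?_
    have : T'.restrict (hm' z) = z⁻¹ • LinearMap.id := by
      ext v
      exact happ' z v v.2
    rw [this, map_smul, LinearMap.trace_id, smul_eq_mul, mul_comm]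

/-- The numbers `Tr(T) Tr(T⁻¹)`, for `T` of finite order, are nonnegative in the sense that a sum
of them vanishes only if each `Tr(T)` does: in `ℂ` they are `|Tr(T)|²`. -/
lemma trace_eq_zero_of_sum_trace_mul_trace_eq_zero {ι : Type*} [Fintype ι] {V : ι → Type*}
    [∀ i, AddCommGroup (V i)] [∀ i, Module k (V i)] [∀ i, FiniteDimensional k (V i)]
    {N : ℕ} (hN : 0 < N) {T T' : ∀ i, Module.End k (V i)} (hT : ∀ i, T i ^ N = 1)
    (hTT' : ∀ i, T' i * T i = 1)
    (h0 : ∑ i, LinearMap.trace k (V i) (T i) * LinearMap.trace k (V i) (T' i) = 0) (i : ι) :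
    LinearMap.trace k (V i) (T i) = 0 := by
  let K := algebraicClosure ℚ k
  have : Algebra.IsAlgebraic ℚ K := algebraicClosure.isAlgebraic ℚ k
  let φ : K →ₐ[ℚ] ℂ := IsAlgClosed.lift
  have key : ∀ i, ∃ z z' : K, (z : k) = LinearMap.trace k (V i) (T i) ∧
      (z' : k) = LinearMap.trace k (V i) (T' i) ∧ φ z' = (starRingEnd ℂ) (φ z) := by
    intro i
    obtain ⟨s, m, hs, h1, h2⟩ := exists_trace_eq_sum_of_pow_eq_one hN (hT i) (hTT' i)
    have hmem : ∀ z ∈ s, z ∈ K := fun z hz => by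
      rw [mem_algebraicClosure_iff]
      exact (IsIntegral.of_pow hN (by rw [hs z hz]; exact isIntegral_one)).isAlgebraic
    refine ⟨∑ z : s, (m z : K) * ⟨z, hmem z z.2⟩, ∑ z : s, (m z : K) * ⟨z, hmem z z.2⟩⁻¹,
      ?_, ?_, ?_⟩
    · rw [h1, ← Finset.sum_coe_sort s]
      push_cast
      rfl
    · rw [h2, ← Finset.sum_coe_sort s]
      push_cast
      rfl
    · simp only [map_sum, map_mul, map_natCast, map_inv₀]
      refine Finset.sum_congr rfl fun z _ => ?_
      congr 1
      apply Complex.inv_eq_conj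
      apply Complex.norm_eq_one_of_pow_eq_one (n := N) _ hN.ne'
      rw [← map_pow, ← map_one φ]
      congr 1
      apply Subtype.ext
      push_cast
      exact hs z z.2
  choose z z' hz hz' hzz using key
  have hsum : ∑ i, z i * z' i = 0 := by
    apply Subtype.ext
    push_cast
    simpa only [hz, hz'] using h0
  have hC := congrArg φ hsum
  simp only [map_sum, map_mul, hzz, Complex.mul_conj, map_zero] at hC
  have hR : ∑ i, Complex.normSq (φ (z i)) = 0 := by exact_mod_cast hC
  have := (Finset.sum_eq_zero_iff_of_nonneg fun i _ => Complex.normSq_nonneg _).1 hR i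
    (Finset.mem_univ i)
  rw [Complex.normSq_eq_zero, map_eq_zero] at this
  rw [← hz, this]
  rfl

end FiniteOrder

section SemisimpleAlgebra

lemma trace_pi_matrix_mul_mul {k ι : Type*} [Field k] [Fintype ι] [DecidableEq ι] {d : ι → ℕ}
    (a b : Π i, Matrix (Fin (d i)) (Fin (d i)) k) :
    LinearMap.trace k _ (LinearMap.mulLeft k a ∘ₗ LinearMap.mulRight k b) =
      ∑ i, (a i).trace * (b i).trace := by
  rw [LinearMap.trace_eq_matrix_trace k
    (Pi.basis fun i => Matrix.stdBasis k (Fin (d i)) (Fin (d i)))]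
  rw [Matrix.trace, Fintype.sum_sigma]
  refine Finset.sum_congr rfl fun i _ => ?_
  rw [Fintype.sum_prod_type, Matrix.trace, Matrix.trace, Finset.sum_mul_sum]
  refine Finset.sum_congr rfl fun p _ => Finset.sum_congr rfl fun q _ => ?_
  simp [LinearMap.toMatrix_apply, Pi.basis_repr, Pi.basis_apply, Matrix.stdBasis_eq_single]
  change (a i * (Matrix.single p q (1 : k) * b i) : Matrix (Fin (d i)) (Fin (d i)) k) p q = _
  simp [Matrix.mul_apply, Matrix.single_apply, Finset.sum_ite_eq, ite_and]

/-- The trace form of a semisimple algebra is nondegenerate: its radical is a left ideal, so it is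
generated by an idempotent `e`, and the trace of left multiplication by `e` is the dimension of
`e A`. -/
lemma eq_zero_of_trace_mulLeft_eq_zero {k A : Type*} [Field k] [CharZero k] [Ring A] [Algebra k A]
    [FiniteDimensional k A] [IsSemisimpleRing A] {x : A}
    (hx : ∀ a, LinearMap.trace k A (LinearMap.mulLeft k (a * x)) = 0) : x = 0 := by
  let I : Submodule A A :=
    { carrier := {x | ∀ a, LinearMap.trace k A (LinearMap.mulLeft k (a * x)) = 0}
      add_mem' := fun {x y} hx hy a => by
        have e : LinearMap.mulLeft k (a * (x + y)) =
            LinearMap.mulLeft k (a * x) + LinearMap.mulLeft k (a * y) := by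
          ext
          simp [mul_add, add_mul, mul_assoc]
        rw [e, map_add, hx, hy, add_zero]
      zero_mem' := fun a => by simp
      smul_mem' := fun c x hx a => by rw [smul_eq_mul, ← mul_assoc]; exact hx _ }
  obtain ⟨J, hJ⟩ := exists_isCompl I
  obtain ⟨e, he, f, hf, hef⟩ := Submodule.mem_sup.1
    (show (1 : A) ∈ I ⊔ J by rw [hJ.sup_eq_top]; trivial)
  have hmul : ∀ y ∈ I, y * e = y := by
    intro y hy
    have h1 : y * f ∈ J := J.smul_mem y hf
    have h2 : y * f ∈ I := by
      have : y * f = y - y * e := by rw [eq_sub_iff_add_eq', ← mul_add, hef, mul_one]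
      rw [this]
      exact I.sub_mem hy (I.smul_mem y he)
    have h3 : y * f ∈ I ⊓ J := ⟨h2, h1⟩
    rw [hJ.inf_eq_bot, Submodule.mem_bot] at h3
    rw [← add_zero (y * e), ← h3, ← mul_add, hef, mul_one]
  have hidem : IsIdempotentElem (LinearMap.mulLeft k e) := by
    ext y
    simp [← mul_assoc, hmul e he]
  have htr : LinearMap.trace k A (LinearMap.mulLeft k e) = 0 := by simpa using he 1
  have h0 := LinearMap.IsIdempotentElem.eq_zero_of_trace_eq_zero hidem htr
  have he0 : e = 0 := by simpa using congr($(h0) 1)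
  rw [← hmul x hx, he0, mul_zero]

/-- Let `σ(x) = w⁻¹ x w` be an inner automorphism of finite order of a semisimple algebra. The trace
of `x ↦ h σ(x)` is the sum of `Tr(hᵢ wᵢ⁻¹) Tr(wᵢ)` over the matrix blocks. For `h = 1` each term is
nonnegative, so if `Tr(σ) = 0` then all `Tr(wᵢ)` vanish, and with them all these traces. -/
lemma trace_mulLeft_comp_eq_zero {k A : Type*} [Field k] [IsAlgClosed k] [CharZero k] [Ring A]
    [Algebra k A] [FiniteDimensional k A] [IsSemisimpleRing A] {w w' : A} (hw : w' * w = 1)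
    {N : ℕ} (hN : 0 < N) (hcomm : ∀ a, w ^ N * a = a * w ^ N)
    (h0 : LinearMap.trace k A (LinearMap.mulLeft k w' ∘ₗ LinearMap.mulRight k w) = 0) (h : A) :
    LinearMap.trace k A (LinearMap.mulLeft k (h * w') ∘ₗ LinearMap.mulRight k w) = 0 := by
  obtain ⟨n, d, hd, ⟨e⟩⟩ := IsSemisimpleRing.exists_algEquiv_pi_matrix_of_isAlgClosed k A
  have htr : ∀ a b : A, LinearMap.trace k A (LinearMap.mulLeft k a ∘ₗ LinearMap.mulRight k b) =
      ∑ i, (e a i).trace * (e b i).trace := by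
    intro a b
    rw [← trace_pi_matrix_mul_mul, ← LinearMap.trace_conj' _ e.toLinearEquiv]
    congr 1
    refine LinearMap.ext fun x => ?_
    simp [LinearEquiv.conj_apply]
  have hW : ∀ i, e w' i * e w i = 1 := fun i => by
    have := congr($(congrArg e hw) i)
    simpa using this
  have hW' : ∀ i, e w i * e w' i = 1 := fun i => mul_eq_one_comm.1 (hW i)
  have hscal : ∀ i, ∃ c : k, c ≠ 0 ∧ (e w i) ^ N = c ^ N • 1 := by
    intro i
    have hc : (e w i) ^ N ∈ Set.range (Matrix.scalar (Fin (d i))) := by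
      rw [Matrix.mem_range_scalar_iff_commute_single']
      intro p q
      have := congr($(congrArg e (hcomm (e.symm (Pi.single i (Matrix.single p q 1))))) i)
      simp only [map_mul, map_pow, AlgEquiv.apply_symm_apply, Pi.mul_apply, Pi.pow_apply,
        Pi.single_eq_same] at this
      exact this.symm
    obtain ⟨c, hc⟩ := hc
    obtain ⟨r, hr⟩ := IsAlgClosed.exists_pow_nat_eq c hN
    refine ⟨r, ?_, ?_⟩
    · rintro rfl
      rw [zero_pow hN.ne'] at hr
      subst hr
      rw [map_zero] at hc
      have h1 : (e w i) ^ N * (e w' i) ^ N = 1 := by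
        have hcm : Commute (e w i) (e w' i) := (hW' i).trans (hW i).symm
        rw [← hcm.mul_pow, hW' i, one_pow]
      rw [← hc, zero_mul] at h1
      exact zero_ne_one h1
    · rw [hr, ← hc, Matrix.smul_one_eq_diagonal]
      rfl
  -- Rescaling `wᵢ` by `cᵢ` makes it of finite order and does not change `Tr(wᵢ⁻¹) Tr(wᵢ)`.
  choose c hc0 hc using hscal
  rw [htr] at h0 ⊢
  have hzero : ∀ i, (e w i).trace = 0 := by
    intro i
    have := trace_eq_zero_of_sum_trace_mul_trace_eq_zero (k := k) (V := fun i => Fin (d i) → k) hN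
      (T := fun i => (c i)⁻¹ • Matrix.toLin' (e w i)) (T' := fun i => c i • Matrix.toLin' (e w' i))
      (fun i => by
        rw [smul_pow, ← Matrix.toLin'_pow, hc, map_smul, Matrix.toLin'_one, smul_smul, ← mul_pow,
          inv_mul_cancel₀ (hc0 i), one_pow, one_smul]
        rfl)
      (fun i => by
        rw [smul_mul_smul_comm, mul_inv_cancel₀ (hc0 i), one_smul, Module.End.mul_eq_comp,
          ← Matrix.toLin'_mul, hW, Matrix.toLin'_one]
        rfl)
      (by
        rw [← h0]
        refine Finset.sum_congr rfl fun i _ => ?_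
        simp only [map_smul, Matrix.trace_toLin'_eq, smul_eq_mul]
        have := hc0 i
        field_simp) i
    simpa [hc0 i] using this
  simp [hzero]

end SemisimpleAlgebra

/-! ### The Larson–Radford theorem -/

section LarsonRadford

variable {k H : Type*} [Field k] [CharZero k] [Ring H] [HopfAlgebra k H]
  [FiniteDimensional k H] [IsSemisimpleRing H] {Λ : H}

/-- In characteristic zero `S²` is inner. The trace form is symmetric and nondegenerate, and the
Frobenius form `μ` has Nakayama automorphism `S²`. They differ by an element `w`, which is therefore
invertible and implements `S²`. -/
lemma exists_unit_antipodeSq_eq (hΛ : IsHaarIntegral k Λ) :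
    ∃ w w' : H, w' * w = 1 ∧ ∀ b, b * w = w * antipodeSq k H b := by
  have hμ := isLeftIntegral_twistedTrace k H
  have h1 := twistedTrace_haar hΛ
  let Φ : H →ₗ[k] Module.Dual k H :=
    LinearMap.compRight k (twistedTrace k H) ∘ₗ (LinearMap.mul k H)
  have hΦ : Function.Surjective Φ := by
    rw [← LinearMap.injective_iff_surjective_of_finrank_eq_finrank
      (Subspace.dual_finrank_eq (K := k)).symm, injective_iff_map_eq_zero]
    intro u hu
    exact eq_zero_of_integral_mul_left hΛ hμ h1 fun a => congr($(hu) a)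
  obtain ⟨u, hu⟩ := hΦ (LinearMap.trace k H ∘ₗ LinearMap.mul k H)
  have hχ : ∀ y, LinearMap.trace k H (LinearMap.mulLeft k y) =
      twistedTrace k H (y * antipodeSq k H u) := fun y => by
    rw [← integral_mul_comm hΛ hμ h1]
    exact congr($(hu.symm) y)
  have hχ' : ∀ a b : H, LinearMap.trace k H (LinearMap.mulLeft k (a * b)) =
      LinearMap.trace k H (LinearMap.mulLeft k (b * a)) := fun a b => by
    rw [LinearMap.mulLeft_mul, LinearMap.mulLeft_mul, LinearMap.trace_comp_comm']
  have hinj : Function.Injective (LinearMap.mulRight k (antipodeSq k H u)) := by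
    rw [injective_iff_map_eq_zero]
    intro x hx
    apply eq_zero_of_trace_mulLeft_eq_zero (k := k)
    intro a
    rw [hχ, mul_assoc, show x * antipodeSq k H u = 0 from hx, mul_zero, map_zero]
  obtain ⟨w', hw'⟩ := LinearMap.injective_iff_surjective.1 hinj 1
  refine ⟨antipodeSq k H u, w', hw', fun b => ?_⟩
  rw [← sub_eq_zero]
  apply eq_zero_of_integral_mul_right hΛ hμ h1
  intro a
  rw [mul_sub, map_sub, sub_eq_zero, ← mul_assoc, ← hχ, hχ', hχ, ← mul_assoc, mul_assoc b,
    integral_mul_comm hΛ hμ h1]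

variable [IsAlgClosed k]

/-- A semisimple Hopf algebra in characteristic zero satisfies `Tr(S²) ≠ 0`. (This is equivalent to
cosemisimplicity.) Otherwise every `Tr(L_h S²)` would vanish, but `Tr(L_Λ S²) = 1`. -/
theorem twistedTrace_one_ne_zero (hΛ : IsHaarIntegral k Λ) : twistedTrace k H 1 ≠ 0 := by
  intro h0
  obtain ⟨w, w', hw, hcomm⟩ := exists_unit_antipodeSq_eq hΛ
  obtain ⟨N, hN, hσN⟩ := exists_antipodeSq_pow_eq_one hΛ
  have hpow : ∀ (m : ℕ) (b : H), b * w ^ m = w ^ m * (antipodeSq k H ^ m) b := by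
    intro m
    induction m with
    | zero => simp
    | succ m ih =>
      intro b
      rw [pow_succ, ← mul_assoc, ih, mul_assoc, hcomm, mul_assoc, pow_succ' (antipodeSq k H)]
      rfl
  have hcent : ∀ a, w ^ N * a = a * w ^ N := fun a => by
    rw [hpow N a, hσN, AlgHom.one_apply]
  have hσ : ∀ h : H, twistedTrace k H h =
      LinearMap.trace k H (LinearMap.mulLeft k (h * w') ∘ₗ LinearMap.mulRight k w) := by
    intro h
    rw [twistedTrace_apply]
    congr 1
    ext x
    change h * antipodeSq k H x = h * w' * (x * w)
    rw [hcomm, mul_assoc h, ← mul_assoc w', hw, one_mul]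
  have := trace_mulLeft_comp_eq_zero hw hN hcent (by rw [← h0, hσ, one_mul]) Λ
  rw [← hσ, twistedTrace_haar hΛ] at this
  exact one_ne_zero this

/-- The distinguished grouplike element is trivial. -/
lemma leftSlice_twistedTrace_haar (hΛ : IsHaarIntegral k Λ) :
    leftSlice (twistedTrace k H) Λ = 1 := by
  have h := leftSlice_integral hΛ (isLeftIntegral_twistedTrace k H) (twistedTrace_haar hΛ) 1
  have h' : leftSlice (twistedTrace k H) (1 : H) = twistedTrace k H 1 • (1 : H) := by
    simp [leftSlice, Algebra.TensorProduct.one_def]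
  rw [h'] at h
  exact (smul_right_injective H (twistedTrace_one_ne_zero hΛ) h).symm

lemma antipodeSq_antipodeSq (hΛ : IsHaarIntegral k Λ) (b : H) :
    antipodeSq k H (antipodeSq k H b) = b := by
  have := mul_leftSlice_eq hΛ (isLeftIntegral_twistedTrace k H) (twistedTrace_haar hΛ) b
  rw [leftSlice_twistedTrace_haar hΛ, one_mul, mul_one] at this
  exact this.symm

end LarsonRadford

section RegularCharacter

variable (k H : Type*) [Field k] [Ring H] [HopfAlgebra k H] [FiniteDimensional k H]

/-- The character of the regular representation of the dual of `H`, viewed as an element of `H`: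
`p(x)` is the trace of `h ↦ p(h₍₁₎) h₍₂₎`. -/
def dualRegularCharacter : H :=
  ∑ i, rightSlice ((Module.finBasis k H).coord i) (Module.finBasis k H i)

variable {k H}

lemma apply_dualRegularCharacter (p : H →ₗ[k] k) :
    p (dualRegularCharacter k H) = LinearMap.trace k H (leftSlice p) := by
  rw [LinearMap.trace_eq_matrix_trace k (Module.finBasis k H), Matrix.trace, dualRegularCharacter,
    map_sum]
  refine Finset.sum_congr rfl fun i _ => ?_
  rw [Matrix.diag_apply, LinearMap.toMatrix_apply, ← Module.Basis.coord_apply, apply_leftSlice]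

/-- The tensor square of the regular representation of the dual of `H` is a multiple of the regular
representation, by means of the isomorphism `y ⊗ z ↦ y z₍₁₎ ⊗ z₍₂₎` of `H ⊗ H`. -/
lemma dualRegularCharacter_mul_self : dualRegularCharacter k H * dualRegularCharacter k H =
    (Module.finrank k H : k) • dualRegularCharacter k H := by
  rw [← sub_eq_zero]
  apply (Module.forall_dual_apply_eq_zero_iff k _).1
  intro p
  rw [map_sub, sub_eq_zero, map_smul, smul_eq_mul]
  let b := Module.finBasis k H
  -- The isomorphism `β(y ⊗ z) = y z₍₁₎ ⊗ z₍₂₎` has inverse `y ⊗ z ↦ y S(z₍₁₎) ⊗ z₍₂₎`.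
  let β : H ⊗[k] H →ₗ[k] H ⊗[k] H :=
    TensorProduct.lift ((LinearMap.mul k (H ⊗[k] H)).compl₁₂
      (TensorProduct.mk k H H |>.flip 1) comul)
  have hβ : ∀ y z, β (y ⊗ₜ[k] z) = (y ⊗ₜ[k] 1) * comul z := fun y z => rfl
  have hsurj : Function.Surjective β := by
    intro t
    induction t with
    | zero => exact ⟨0, map_zero β⟩
    | add x y hx hy =>
      obtain ⟨a, rfl⟩ := hx
      obtain ⟨c, rfl⟩ := hy
      exact ⟨a + c, map_add β a c⟩
    | tmul y z =>
      refine ⟨∑ i ∈ (ℛ k z).index, (y * antipode k ((ℛ k z).left i)) ⊗ₜ[k] (ℛ k z).right i, ?_⟩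
      have := congrArg (fun t => (y ⊗ₜ[k] (1 : H)) * t) (sum_antipode_tmul_mul_comul (ℛ k z))
      simpa [Finset.mul_sum, ← mul_assoc, hβ] using this
  let e := LinearEquiv.ofBijective β ⟨LinearMap.injective_iff_surjective.2 hsurj, hsurj⟩
  -- `Ψ(y ⊗ z) = p(y₍₁₎ z₍₁₎) y₍₂₎ ⊗ z₍₂₎` has trace `p(x²)`, and `β`
  -- conjugates it to `leftSlice p ⊗ id`.
  let Ψ : H ⊗[k] H →ₗ[k] H ⊗[k] H :=
    ∑ a, TensorProduct.map (leftSlice (p ∘ₗ LinearMap.mulRight k (b a))) (leftSlice (b.coord a))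
  have hexp : ∀ a s : H, ∑ i, b.coord i s • p (a * b i) = p (a * s) :=
    sum_coord_smul_apply_mul b p
  have hprod : ∀ y z : H, ∑ a, leftSlice (p ∘ₗ LinearMap.mulRight k (b a)) y *
      leftSlice (b.coord a) z = leftSlice p (y * z) := by
    intro y z
    have h2 : leftSlice p (y * z) = evalLeft p (comul y * comul z) := by
      rw [← Bialgebra.comul_mul]; rfl
    rw [h2]
    conv_rhs => rw [← (ℛ k y).eq, ← (ℛ k z).eq]
    simp only [leftSlice_repr _ (ℛ k y), leftSlice_repr _ (ℛ k z), Finset.sum_mul_sum, map_sum,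
      Algebra.TensorProduct.tmul_mul_tmul, evalLeft_tmul, LinearMap.comp_apply,
      LinearMap.mulRight_apply]
    rw [Finset.sum_comm]
    refine Finset.sum_congr rfl fun i _ => ?_
    rw [Finset.sum_comm]
    refine Finset.sum_congr rfl fun j _ => ?_
    rw [← hexp, Finset.sum_smul]
    refine Finset.sum_congr rfl fun a _ => ?_
    rw [smul_mul_smul_comm, smul_eq_mul, mul_comm (p _)]
  have hconj : e.conj Ψ = (leftSlice p).rTensor H := by
    rw [LinearEquiv.conj_apply, LinearMap.comp_assoc]
    have : (e : H ⊗[k] H →ₗ[k] H ⊗[k] H) ∘ₗ Ψ = (leftSlice p).rTensor H ∘ₗ e := by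
      apply TensorProduct.ext'
      intro y z
      change β (Ψ (y ⊗ₜ z)) = (leftSlice p).rTensor H (β (y ⊗ₜ z))
      simp only [Ψ, LinearMap.sum_apply, TensorProduct.map_tmul, map_sum, hβ, comul_leftSlice]
      conv_lhs => rw [← (ℛ k z).eq]
      conv_rhs => rw [← (ℛ k z).eq]
      simp only [map_sum, LinearMap.rTensor_tmul, Finset.mul_sum,
        Algebra.TensorProduct.tmul_mul_tmul, one_mul]
      rw [Finset.sum_comm]
      refine Finset.sum_congr rfl fun i _ => ?_
      rw [← TensorProduct.sum_tmul, hprod]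
    rw [← LinearMap.comp_assoc, this, LinearMap.comp_assoc]
    simp
  have htr := LinearMap.trace_conj' Ψ e
  rw [hconj, LinearMap.rTensor, LinearMap.trace_tensorProduct', LinearMap.trace_id,
    ← apply_dualRegularCharacter] at htr
  rw [mul_comm _ (p _), htr, map_sum]
  simp only [LinearMap.trace_tensorProduct', ← apply_dualRegularCharacter]
  rw [← hexp]
  refine Finset.sum_congr rfl fun a _ => ?_
  rw [smul_eq_mul, mul_comm]
  rfl

lemma antipodeSq_dualRegularCharacter
    (hσ : ∀ b : H, antipodeSq k H (antipodeSq k H b) = b) :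
    antipodeSq k H (dualRegularCharacter k H) = dualRegularCharacter k H := by
  rw [← sub_eq_zero]
  apply (Module.forall_dual_apply_eq_zero_iff k _).1
  intro p
  rw [map_sub, sub_eq_zero]
  have e : leftSlice (p ∘ₗ (antipodeSq k H).toLinearMap) =
      (antipodeSq k H).toLinearMap ∘ₗ leftSlice p ∘ₗ (antipodeSq k H).toLinearMap := by
    ext h
    simp [← antipodeSq_leftSlice, hσ]
  change (p ∘ₗ (antipodeSq k H).toLinearMap) _ = _
  rw [apply_dualRegularCharacter, apply_dualRegularCharacter, e, LinearMap.trace_comp_comm',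
    LinearMap.comp_assoc]
  have hσ' : (antipodeSq k H).toLinearMap ∘ₗ (antipodeSq k H).toLinearMap = LinearMap.id := by
    ext h
    exact hσ h
  rw [hσ', LinearMap.comp_id]

end RegularCharacter

section Involutory

lemma trace_eq_finrank_range_of_isIdempotentElem {k V : Type*} [Field k]
    [AddCommGroup V] [Module k V] [FiniteDimensional k V] {P : Module.End k V}
    (hP : IsIdempotentElem P) :
    LinearMap.trace k V P = (Module.finrank k (LinearMap.range P) : k) :=
  (LinearMap.IsIdempotentElem.isProj_range _ hP).trace

/-- An endomorphism `B` with `B³ = B` has integral trace, being the difference of the idempotents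
`(B² + B) / 2` and `(B² - B) / 2`. -/
lemma exists_trace_eq_intCast_of_mul_mul_self {k V : Type*} [Field k] [CharZero k]
    [AddCommGroup V] [Module k V] [FiniteDimensional k V] {B : Module.End k V}
    (hB : B * B * B = B) :
    ∃ m : ℤ, LinearMap.trace k V B = m := by
  have h2 : (B * B) * (B * B) = B * B := by rw [← mul_assoc, hB]
  have h3 : B * (B * B) = B := by rw [← mul_assoc, hB]
  have hp : IsIdempotentElem ((2 : k)⁻¹ • (B * B + B)) := by
    rw [IsIdempotentElem, smul_mul_smul_comm, add_mul, mul_add, mul_add, h2, hB, h3]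
    rw [show B * B + B + (B + B * B) = (2 : k) • (B * B + B) by rw [two_smul]; abel, smul_smul]
    norm_num
  have hm : IsIdempotentElem ((2 : k)⁻¹ • (B * B - B)) := by
    rw [IsIdempotentElem, smul_mul_smul_comm, sub_mul, mul_sub, mul_sub, h2, hB, h3]
    rw [show B * B - B - (B - B * B) = (2 : k) • (B * B - B) by rw [two_smul]; abel, smul_smul]
    norm_num
  have h := congrArg₂ (· - ·) (trace_eq_finrank_range_of_isIdempotentElem hp)
    (trace_eq_finrank_range_of_isIdempotentElem hm)
  refine ⟨(Module.finrank k (LinearMap.range ((2 : k)⁻¹ • (B * B + B))) : ℤ) -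
    Module.finrank k (LinearMap.range ((2 : k)⁻¹ • (B * B - B))), ?_⟩
  push_cast
  rw [← h, ← map_sub, ← smul_sub]
  congr 1
  rw [show B * B + B - (B * B - B) = (2 : k) • B by rw [two_smul]; abel, smul_smul]
  norm_num

variable {k H : Type*} [Field k] [IsAlgClosed k] [CharZero k] [Ring H] [HopfAlgebra k H]
  [FiniteDimensional k H] [IsSemisimpleRing H]

variable (k H) in
/-- The Larson–Radford theorem: a semisimple Hopf algebra over an algebraically closed field of
characteristic zero is involutory. With `n = dim H` and `x` the regular character of the dual,
`x / n` is an idempotent fixed by `S²`, so `Tr(S²) / n = Tr(L_{x/n} S²)` is an integer. Since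
`S⁴ = 1` and `Tr(S²) ≠ 0`, it follows that `Tr(S²) = ± n` and `S² = ± 1`. -/
theorem isInvolutory_of_isSemisimpleRing : IsInvolutory k H := by
  obtain ⟨Λ, hΛ, -⟩ := existsUnique_isHaarIntegral k H
  have hσ := antipodeSq_antipodeSq hΛ
  set σ := antipodeSq k H with hσdef
  have hnontriv : Nontrivial H := by
    refine ⟨1, 0, fun h => ?_⟩
    have := congrArg (counit (R := k)) h
    simp at this
  have hn0 : (Module.finrank k H : k) ≠ 0 := by
    exact_mod_cast (Module.finrank_pos (R := k) (M := H)).ne'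
  have ht0 := twistedTrace_one_ne_zero hΛ
  have ht1 : twistedTrace k H 1 = LinearMap.trace k H σ.toLinearMap := by
    rw [twistedTrace_apply, LinearMap.mulLeft_one, LinearMap.id_comp]
  let x := dualRegularCharacter k H
  let n : k := Module.finrank k H
  let e : H := n⁻¹ • x
  have hee : e * e = e := by
    simp only [e, smul_mul_smul_comm, x, dualRegularCharacter_mul_self, smul_smul]
    congr 1
    change n⁻¹ * n⁻¹ * n = n⁻¹
    rw [mul_assoc, inv_mul_cancel₀ hn0, mul_one]
  have hσe : σ e = e := by
    simp only [e, x, map_smul, hσdef]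
    rw [antipodeSq_dualRegularCharacter hσ]
  have htx : twistedTrace k H x = twistedTrace k H 1 := by
    have e' : leftSlice (twistedTrace k H) = (twistedTrace k H).smulRight (1 : H) := by
      ext h
      rw [leftSlice_integral hΛ (isLeftIntegral_twistedTrace k H) (twistedTrace_haar hΛ),
        leftSlice_twistedTrace_haar hΛ]
      rfl
    simp only [x, apply_dualRegularCharacter]
    rw [e', LinearMap.trace_smulRight]
  let B : Module.End k H := LinearMap.mulLeft k e ∘ₗ σ.toLinearMap
  have hBapp : ∀ y, B y = e * σ y := fun y => rfl
  have hB : B * B * B = B := by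
    ext y
    simp only [Module.End.mul_apply, hBapp, map_mul, hσe, hσ, ← mul_assoc, hee]
  obtain ⟨m, hm⟩ := exists_trace_eq_intCast_of_mul_mul_self hB
  have hBt : LinearMap.trace k H B = n⁻¹ * twistedTrace k H 1 := by
    rw [← htx, ← smul_eq_mul, ← map_smul]
    rfl
  -- `Q` is the projection to the `-1`-eigenspace of `S²`.
  let Q : Module.End k H := (2 : k)⁻¹ • (1 - σ.toLinearMap)
  have hQ : IsIdempotentElem Q := by
    have hss : σ.toLinearMap * σ.toLinearMap = (1 : Module.End k H) := by
      ext y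
      exact hσ y
    rw [IsIdempotentElem]
    simp only [Q]
    rw [smul_mul_smul_comm, mul_sub, sub_mul, sub_mul, hss, one_mul, mul_one, one_mul]
    rw [show (1 : Module.End k H) - σ.toLinearMap - (σ.toLinearMap - 1) =
      (2 : k) • (1 - σ.toLinearMap) by rw [two_smul]; abel, smul_smul]
    norm_num
  have hQt := trace_eq_finrank_range_of_isIdempotentElem hQ
  set r := Module.finrank k (LinearMap.range Q) with hr
  have hrn : r ≤ Module.finrank k H := Submodule.finrank_le _
  have ht : twistedTrace k H 1 = n - 2 * r := by
    rw [← hQt, ht1]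
    simp only [Q, map_smul, map_sub, LinearMap.trace_one, smul_eq_mul, n]
    ring
  have hint : (Module.finrank k H : ℤ) - 2 * r = Module.finrank k H * m := by
    have : n * m = n - 2 * r := by
      rw [← hm, hBt, ← mul_assoc, mul_inv_cancel₀ hn0, one_mul, ht]
    have h2 : ((Module.finrank k H * m : ℤ) : k) = ((Module.finrank k H - 2 * r : ℤ) : k) := by
      push_cast
      exact this
    exact_mod_cast h2.symm
  have hm0 : m ≠ 0 := by
    rintro rfl
    apply ht0
    rw [Int.cast_zero, hBt] at hm
    exact (mul_eq_zero.1 hm).resolve_left (inv_ne_zero hn0)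
  have hnpos : (0 : ℤ) < Module.finrank k H := by exact_mod_cast Module.finrank_pos
  have hrn' : (r : ℤ) ≤ Module.finrank k H := by exact_mod_cast hrn
  rcases lt_or_gt_of_ne hm0 with hneg | hpos
  -- A negative multiple forces `S² = -1`, which fails at `1`.
  · exfalso
    have hrn2 : r = Module.finrank k H := by
      have : (Module.finrank k H : ℤ) * m ≤ Module.finrank k H * (-1) :=
        mul_le_mul_of_nonneg_left (by omega) hnpos.le
      omega
    have htop : LinearMap.range Q = ⊤ := Submodule.eq_top_of_finrank_eq hrn2
    obtain ⟨y, hy⟩ := LinearMap.range_eq_top.1 htop 1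
    have h1 : Q 1 = 0 := by simp [Q]
    have h2 : Q (Q y) = Q y := congr($(hQ.eq) y)
    rw [hy, h1] at h2
    exact zero_ne_one h2
  · have hr0 : r = 0 := by
      have : (Module.finrank k H : ℤ) * 1 ≤ Module.finrank k H * m :=
        mul_le_mul_of_nonneg_left (by omega) hnpos.le
      omega
    have hQ0 : Q = 0 := by
      rw [← LinearMap.range_eq_bot]
      exact Submodule.finrank_eq_zero.1 hr0
    intro h
    have := congr($(hQ0) h)
    simp only [Q, LinearMap.smul_apply, LinearMap.zero_apply, smul_eq_zero, inv_eq_zero,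
      OfNat.ofNat_ne_zero, false_or, LinearMap.sub_apply, Module.End.one_apply, sub_eq_zero] at this
    exact this.symm

end Involutory

/-! ### Invariant bilinear forms and the indicator -/

section Forms

variable {k H V : Type*} [Field k] [Ring H] [HopfAlgebra k H] [AddCommGroup V] [Module k V]

variable (k V) in
/-- Linear maps `V → L ⊗ V^∨`, for `L = k`, are the same thing as bilinear forms on `V`. -/
def formEquiv : (V →ₗ[k] k ⊗[k] Module.Dual k V) ≃ₗ[k] LinearMap.BilinForm k V :=
  LinearEquiv.congrRight (TensorProduct.lid k (Module.Dual k V))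

lemma formEquiv_apply (f : V →ₗ[k] k ⊗[k] Module.Dual k V) (v w : V) :
    formEquiv k V f v w = TensorProduct.lid k (Module.Dual k V) (f v) w := rfl

/-- The action on `L ⊗ V^∨`, after the identification of `k ⊗ V^∨` with `V^∨`. -/
lemma lid_sharpRep_apply (α : H →ₐ[k] k) (ρ : H →ₐ[k] Module.End k V) (h : H)
    (t : k ⊗[k] Module.Dual k V) (w : V) :
    TensorProduct.lid k (Module.Dual k V) (sharpRep (charRep α) ρ h t) w =
      ∑ i ∈ (ℛ k h).index, α ((ℛ k h).left i) *
        TensorProduct.lid k (Module.Dual k V) t (ρ (antipode k ((ℛ k h).right i)) w) := by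
  rw [sharpRep, tensorRep_repr _ _ (ℛ k h)]
  induction t with
  | zero => simp
  | add x y hx hy => simp only [map_add, LinearMap.add_apply, hx, hy, mul_add,
      Finset.sum_add_distrib]
  | tmul c φ => simp [charRep_apply, dualRep_apply, LinearMap.sum_apply, mul_assoc]

lemma mem_homH_sharp_iff (α : H →ₐ[k] k) (ρ : H →ₐ[k] Module.End k V)
    (f : V →ₗ[k] k ⊗[k] Module.Dual k V) :
    f ∈ homH ρ (sharpRep (charRep α) ρ) ↔ ∀ (h : H) (v w : V), formEquiv k V f (ρ h v) w =
      ∑ i ∈ (ℛ k h).index, α ((ℛ k h).left i) *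
        formEquiv k V f v (ρ (antipode k ((ℛ k h).right i)) w) := by
  constructor
  · intro hf h v w
    rw [formEquiv_apply, hf h v, lid_sharpRep_apply]
    rfl
  · intro hf h v
    apply (TensorProduct.lid k (Module.Dual k V)).injective
    ext w
    rw [lid_sharpRep_apply]
    exact hf h v w

/-- `H`-linear maps `V → L ⊗ V^∨` correspond to invariant bilinear forms. -/
lemma mem_homH_sharp_iff_isInvariantForm (α : H →ₐ[k] k) (ρ : H →ₐ[k] Module.End k V)
    (f : V →ₗ[k] k ⊗[k] Module.Dual k V) :
    f ∈ homH ρ (sharpRep (charRep α) ρ) ↔ IsInvariantForm α ρ (formEquiv k V f) := by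
  rw [mem_homH_sharp_iff]
  set b := formEquiv k V f
  constructor
  -- `b(h₍₁₎ v, h₍₂₎ w) = α(h₍₁₎) b(v, S(h₍₂₎) h₍₃₎ w) = α(h) b(v, w)`
  · intro hb h v w
    let C : V → V → H ⊗[k] H →ₗ[k] k := fun v w => LinearMap.mul' k k ∘ₗ
      TensorProduct.map α.toLinearMap (b v ∘ₗ ρ.toLinearMap.flip w)
    have hC : ∀ h v w, b (ρ h v) w = C v w ((antipode k).lTensor H (comul h)) := by
      intro h v w
      rw [hb h v w, ← (ℛ k h).eq]
      simp [C]
    have hC' : ∀ v w s t, C v (ρ s w) t = C v w (t * (1 ⊗ₜ s)) := by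
      intro v w s t
      induction t with
      | zero => simp
      | add x y hx hy => simp only [map_add, add_mul, hx, hy]
      | tmul x y => simp [C]
    rw [tensorRep_repr _ _ (ℛ k h)]
    simp only [LinearMap.sum_apply, TensorProduct.map_tmul, map_sum, TensorProduct.lift.tmul, hC,
      hC']
    rw [← map_sum, sum_lTensor_antipode_comul_mul]
    simp [C]
  -- `b(h v, w) = b(h₍₁₎ v, h₍₂₎ S(h₍₃₎) w) = α(h₍₁₎) b(v, S(h₍₂₎) w)`
  · intro hb h v w
    let B : V → V → H ⊗[k] H →ₗ[k] k := fun v w => TensorProduct.lift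
      (b.compl₁₂ (ρ.toLinearMap.flip v) (ρ.toLinearMap.flip w))
    have hB : ∀ h v w, B v w (comul h) = α h * b v w := by
      intro h v w
      rw [← hb, tensorRep_repr _ _ (ℛ k h), ← (ℛ k h).eq]
      simp [B]
    have hB' : ∀ v w s t, B v (ρ s w) t = B v w (t * (1 ⊗ₜ s)) := by
      intro v w s t
      induction t with
      | zero => simp
      | add x y hx hy => simp only [map_add, add_mul, hx, hy]
      | tmul x y => simp [B]
    have h1 : b (ρ h v) w = B v w (h ⊗ₜ 1) := by simp [B]
    rw [h1, ← sum_comul_mul_tmul_antipode (ℛ k h), map_sum]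
    simp only [← hB', hB]

variable (k) in
lemma coevaluation_self : coevaluation k k 1 = (1 : k) ⊗ₜ[k] (LinearMap.id : k →ₗ[k] k) := by
  rw [coevaluation_apply_one]
  have : ∀ i, (Module.Basis.ofVectorSpace k k) i ⊗ₜ[k] (Module.Basis.ofVectorSpace k k).coord i =
      (1 : k) ⊗ₜ[k] ((Module.Basis.ofVectorSpace k k) i •
        (Module.Basis.ofVectorSpace k k).coord i) := by
    intro i
    rw [← TensorProduct.smul_tmul, smul_eq_mul, mul_one]
  simp only [this]
  rw [← TensorProduct.tmul_sum]
  congr 1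
  ext
  have := (Module.Basis.ofVectorSpace k k).sum_repr 1
  simp only [LinearMap.sum_apply, LinearMap.smul_apply, smul_eq_mul, LinearMap.id_apply,
    Module.Basis.coord_apply]
  simpa only [smul_eq_mul, mul_comm] using this

/-- In terms of bilinear forms, the transposition map exchanges the two arguments. -/
lemma formEquiv_transposition (f : V →ₗ[k] k ⊗[k] Module.Dual k V) (v w : V) :
    formEquiv k V (sharpMap k k f ∘ₗ omega k k V) v w = formEquiv k V f w v := by
  have h1 : omega k k V v = (1 : k) ⊗ₜ[k]
      (xi k k (Module.Dual k V) (LinearMap.id ⊗ₜ[k] Module.Dual.eval k V v)) := by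
    simp [omega, eta, coevaluation_self]
  rw [formEquiv_apply, formEquiv_apply, LinearMap.comp_apply, h1]
  simp only [sharpMap, LinearMap.lTensor_tmul, TensorProduct.lid_tmul, one_smul,
    LinearMap.dualMap_apply]
  generalize f w = t
  induction t with
  | zero => simp
  | add x y hx hy => simp only [map_add, LinearMap.add_apply, hx, hy]
  | tmul c φ => simp [xi]

lemma transposition_transposition (hS : IsInvolutory k H) {α : H →ₐ[k] k} (hα : IsCentralChar α)
    (ρ : H →ₐ[k] Module.End k V) (f : homH ρ (sharpRep (charRep α) ρ)) :
    transposition hS hα.isFlippable ρ ρ (transposition hS hα.isFlippable ρ ρ f) = f := by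
  apply Subtype.ext
  apply (formEquiv k V).injective
  ext v w
  exact (formEquiv_transposition _ v w).trans (formEquiv_transposition f.1 w v)

lemma indicator_eq_zero (hS : IsInvolutory k H) {α : H →ₐ[k] k} (hα : IsCentralChar α)
    (ρ : H →ₐ[k] Module.End k V)
    (h0 : ∀ f : homH ρ (sharpRep (charRep α) ρ), f = 0) :
    indicator hS hα.isFlippable ρ = 0 := by
  have : transposition hS hα.isFlippable ρ ρ = 0 := by
    ext1 f
    rw [h0 f, map_zero, LinearMap.zero_apply]
  rw [indicator, this, map_zero]

/-- The element `z = α(S(Λ₍₁₎)) Λ₍₂₎`. If `S² = id` and `Λ` is a Haar integral, it is an idempotent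
with `z h = α(h) z` and `α(z) = 1`. -/
def charIdempotent (α : H →ₐ[k] k) (Λ : H) : H := leftSlice (α.toLinearMap ∘ₗ antipode k) Λ

lemma charIdempotent_mul (hS : IsInvolutory k H) {Λ : H} (hΛ : IsHaarIntegral k Λ)
    (α : H →ₐ[k] k) (h : H) : charIdempotent α Λ * h = α h • charIdempotent α Λ := by
  have := congrArg (evalLeft (α.toLinearMap ∘ₗ antipode k)) (hΛ.comul_mul_tmul (antipode k h))
  rw [hS, evalLeft_mul, evalLeft_mul, mul_one, LinearMap.mulRight_one, LinearMap.comp_id] at this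
  refine this.symm.trans ?_
  have e : (α.toLinearMap ∘ₗ antipode k) ∘ₗ LinearMap.mulRight k (antipode k h) =
      α h • (α.toLinearMap ∘ₗ antipode k) := by
    ext x
    simp [antipode_mul_antidistrib, hS h]
  rw [e, charIdempotent, leftSlice, LinearMap.comp_apply, ← (ℛ k Λ).eq]
  simp [Finset.smul_sum, smul_smul]

lemma apply_charIdempotent {Λ : H} (hΛ : IsHaarIntegral k Λ) (α : H →ₐ[k] k) :
    α (charIdempotent α Λ) = 1 := by
  rw [charIdempotent, leftSlice_repr _ (ℛ k Λ), map_sum]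
  simp only [map_smul, LinearMap.comp_apply, AlgHom.toLinearMap_apply, smul_eq_mul, ← map_mul]
  rw [← map_sum, sum_antipode_mul_eq_smul, hΛ.2.2, one_smul, map_one]

lemma indicatorFunctional_apply (α : H →ₐ[k] k) (ρ : H →ₐ[k] Module.End k V) (Λ : H) :
    indicatorFunctional α ρ Λ = LinearMap.trace k V (ρ (LinearMap.mul' k H
      (comul (charIdempotent α Λ)))) := by
  rw [charIdempotent, leftSlice_repr _ (ℛ k Λ), indicatorFunctional]
  simp only [LinearMap.comp_apply]
  rw [← (ℛ k Λ).eq]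
  simp

end Forms

section Trace

variable {k H V : Type*} [Field k] [Ring H] [HopfAlgebra k H] [AddCommGroup V] [Module k V]
  [FiniteDimensional k V]

lemma trace_map_comp_comm (A B : Module.End k V) :
    LinearMap.trace k (V ⊗[k] V) (TensorProduct.map A B ∘ₗ (TensorProduct.comm k V V).toLinearMap) =
      LinearMap.trace k V (A * B) := by
  let b := Module.finBasis k V
  rw [LinearMap.trace_eq_matrix_trace k (b.tensorProduct b), LinearMap.trace_eq_matrix_trace k b,
    LinearMap.toMatrix_mul, Matrix.trace, Matrix.trace, Fintype.sum_prod_type]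
  refine Finset.sum_congr rfl fun i _ => ?_
  rw [Matrix.diag_apply, Matrix.mul_apply]
  refine Finset.sum_congr rfl fun j _ => ?_
  simp [LinearMap.toMatrix_apply, mul_comm]

lemma trace_homH_comp_comm {W E : Type*} [AddCommGroup W] [Module k W] [FiniteDimensional k W]
    [AddCommGroup E] [Module k E] [FiniteDimensional k E] {ρ : H →ₐ[k] Module.End k V}
    {σ : H →ₐ[k] Module.End k W} (p : E →ₗ[k] homH ρ σ) (i : homH ρ σ →ₗ[k] E) :
    LinearMap.trace k (homH ρ σ) (p ∘ₗ i) = LinearMap.trace k E (i ∘ₗ p) :=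
  LinearMap.trace_comp_comm' i p

/-- The formula for the twisted indicator, which does not need `V` to be simple. The element
`z = α(S(Λ₍₁₎)) Λ₍₂₎` acts on `(V ⊗ V)^∨` as a projection to the space of invariant forms. So the
trace of the flip on the latter is the trace on `V ⊗ V` of the action of `z` composed with the
flip, which is `Tr(z₍₁₎ z₍₂₎)`. -/
lemma indicator_eq_indicatorFunctional (hS : IsInvolutory k H) {α : H →ₐ[k] k}
    (hα : IsCentralChar α) (ρ : H →ₐ[k] Module.End k V) {Λ : H} (hΛ : IsHaarIntegral k Λ) :
    indicator hS hα.isFlippable ρ = indicatorFunctional α ρ Λ := by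
  set z := charIdempotent α Λ with hz
  let W := homH ρ (sharpRep (charRep α) ρ)
  let E := Module.Dual k (V ⊗[k] V)
  let Φ : (V →ₗ[k] k ⊗[k] Module.Dual k V) ≃ₗ[k] E :=
    formEquiv k V ≪≫ₗ TensorProduct.lift.equiv (RingHom.id k) V V k
  have hmem : ∀ f, f ∈ W ↔ ∀ h, Φ f ∘ₗ tensorRep ρ ρ h = α h • Φ f := by
    intro f
    rw [mem_homH_sharp_iff_isInvariantForm]
    constructor
    · intro hf h
      apply TensorProduct.ext'
      intro v w
      exact hf h v w
    · intro hf h v w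
      exact congr($(hf h) (v ⊗ₜ w))
  let P : E →ₗ[k] E := (tensorRep ρ ρ z).dualMap
  let F : E →ₗ[k] E := (TensorProduct.comm k V V).toLinearMap.dualMap
  let i : W →ₗ[k] E := Φ.toLinearMap ∘ₗ W.subtype
  let p : E →ₗ[k] W := (Φ.symm.toLinearMap ∘ₗ P).codRestrict W (fun β => by
    rw [hmem]
    intro h
    have e : Φ ((Φ.symm.toLinearMap ∘ₗ P) β) = β ∘ₗ tensorRep ρ ρ z :=
      Φ.apply_symm_apply _
    rw [e, LinearMap.comp_assoc, ← Module.End.mul_eq_comp (tensorRep ρ ρ z), ← map_mul,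
      charIdempotent_mul hS hΛ, map_smul, LinearMap.comp_smul])
  have hip : i ∘ₗ p = P := by
    ext1 β
    exact Φ.apply_symm_apply _
  have hpi : p ∘ₗ i = LinearMap.id := by
    ext1 f
    apply Subtype.ext
    change Φ.symm (Φ f.1 ∘ₗ tensorRep ρ ρ z) = f.1
    rw [(hmem f.1).1 f.2, apply_charIdempotent hΛ, one_smul, Φ.symm_apply_apply]
  have hτ : i ∘ₗ transposition hS hα.isFlippable ρ ρ = F ∘ₗ i := by
    ext1 f
    apply TensorProduct.ext'
    intro v w
    exact formEquiv_transposition f.1 v w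
  have h1 : transposition hS hα.isFlippable ρ ρ = p ∘ₗ F ∘ₗ i := by
    rw [← hτ, ← LinearMap.comp_assoc, hpi, LinearMap.id_comp]
  have h2 : (F ∘ₗ i) ∘ₗ p = Module.Dual.transpose
      (tensorRep ρ ρ z ∘ₗ (TensorProduct.comm k V V).toLinearMap) := by
    rw [LinearMap.comp_assoc, hip]
    rfl
  rw [indicator, h1]
  refine (trace_homH_comp_comm p (F ∘ₗ i)).trans ?_
  rw [h2, LinearMap.trace_transpose',
    tensorRep_repr _ _ (ℛ k z), indicatorFunctional_apply]
  rw [← hz]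
  conv_rhs => rw [← (ℛ k z).eq]
  have hsum : (∑ j ∈ (ℛ k z).index, TensorProduct.map (ρ ((ℛ k z).left j))
      (ρ ((ℛ k z).right j))) ∘ₗ (TensorProduct.comm k V V).toLinearMap =
      ∑ j ∈ (ℛ k z).index, TensorProduct.map (ρ ((ℛ k z).left j)) (ρ ((ℛ k z).right j)) ∘ₗ
        (TensorProduct.comm k V V).toLinearMap :=
    map_sum (LinearMap.lcomp k (V ⊗[k] V) (TensorProduct.comm k V V).toLinearMap) _ _
  rw [hsum]
  simp only [map_sum, trace_map_comp_comm, LinearMap.mul'_apply, map_mul]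

end Trace

section Schur

variable {k H V : Type*} [Field k] [Ring H] [HopfAlgebra k H] [AddCommGroup V] [Module k V]
  [Module H V] [IsScalarTower k H V] [IsSimpleModule H V]
  {W : Type*} [AddCommGroup W] [Module k W] {σ : H →ₐ[k] Module.End k W}

lemma injective_of_mem_homH {f : V →ₗ[k] W} (hf : f ∈ homH (actRep k H V) σ) (hf0 : f ≠ 0) :
    Function.Injective f := by
  let K : Submodule H V :=
    { carrier := {v | f v = 0}
      add_mem' := fun {a b} ha hb => by
        simp only [Set.mem_ofPred_eq] at *
        rw [map_add, ha, hb, add_zero]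
      zero_mem' := map_zero f
      smul_mem' := fun h v hv => by
        simp only [Set.mem_ofPred_eq] at *
        have := hf h v
        rw [hv, map_zero] at this
        exact this }
  rcases eq_bot_or_eq_top K with h | h
  · rw [injective_iff_map_eq_zero]
    intro v hv
    have : v ∈ K := hv
    rwa [h, Submodule.mem_bot] at this
  · exfalso
    apply hf0
    ext v
    have : v ∈ K := h ▸ Submodule.mem_top
    exact this

/-- Schur's lemma, for maps to a module of the same dimension. -/
lemma exists_eq_smul_of_mem_homH [IsAlgClosed k] [FiniteDimensional k V] [FiniteDimensional k W]
    (hd : Module.finrank k V = Module.finrank k W) {f f' : V →ₗ[k] W}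
    (hf : f ∈ homH (actRep k H V) σ) (hf' : f' ∈ homH (actRep k H V) σ) (hf0 : f ≠ 0) :
    ∃ c : k, f' = c • f := by
  have : Nontrivial V := IsSimpleModule.nontrivial H V
  let e := LinearEquiv.ofInjectiveOfFinrankEq f (injective_of_mem_homH hf hf0) hd
  obtain ⟨c, hc⟩ := Module.End.exists_eigenvalue (e.symm.toLinearMap ∘ₗ f')
  obtain ⟨v, hv⟩ := hc.exists_hasEigenvector
  have hv1 : f' v = c • f v := by
    have := congrArg e hv.apply_eq_smul
    rw [LinearMap.comp_apply, LinearEquiv.coe_coe, e.apply_symm_apply, map_smul] at this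
    exact this
  refine ⟨c, ?_⟩
  by_contra hne
  have hg : f' - c • f ∈ homH (actRep k H V) σ :=
    Submodule.sub_mem _ hf' (Submodule.smul_mem _ c hf)
  apply hv.2
  apply injective_of_mem_homH hg (sub_ne_zero.2 hne)
  simp [hv1]

/-- An involution of the space of homomorphisms between two modules of the same dimension, the
first one simple, is a sign. -/
lemma trace_of_involution_homH [IsAlgClosed k] [FiniteDimensional k V] [FiniteDimensional k W]
    (hd : Module.finrank k V = Module.finrank k W)
    (τ : homH (actRep k H V) σ →ₗ[k] homH (actRep k H V) σ) (hτ : ∀ g, τ (τ g) = g)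
    {f : homH (actRep k H V) σ} (hf : f ≠ 0) :
    LinearMap.trace k (homH (actRep k H V) σ) τ ∈ ({1, -1} : Set k) ∧
      τ f = LinearMap.trace k (homH (actRep k H V) σ) τ • f := by
  have hspan : ∀ g, ∃ c : k, c • f = g := by
    intro g
    obtain ⟨c, hc⟩ := exists_eq_smul_of_mem_homH hd f.2 g.2 (fun h => hf (Subtype.ext h))
    exact ⟨c, Subtype.ext hc.symm⟩
  obtain ⟨c, hc⟩ := hspan (τ f)
  have hτ' : τ = c • LinearMap.id := by
    ext1 g
    obtain ⟨d, rfl⟩ := hspan g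
    rw [map_smul, ← hc, LinearMap.smul_apply, LinearMap.id_apply, smul_comm]
  have hν : LinearMap.trace k (homH (actRep k H V) σ) τ = c := by
    rw [hτ', map_smul, LinearMap.trace_id, finrank_eq_one f hf hspan]
    simp
  rw [hν]
  refine ⟨?_, hc.symm⟩
  have h2 := hτ f
  rw [← hc, map_smul, ← hc, smul_smul] at h2
  have h3 : (c * c) • f.1 = f.1 := congrArg Subtype.val h2
  have h4 : (c * c - 1) • f.1 = 0 := by rw [sub_smul, h3, one_smul, sub_self]
  exact mul_self_eq_one_iff.1 (sub_eq_zero.1 ((smul_eq_zero.1 h4).resolve_right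
    fun h => hf (Subtype.ext h)))

end Schur

section Simple

variable {k H V : Type*} [Field k] [IsAlgClosed k] [Ring H]
    [HopfAlgebra k H] {α : H →ₐ[k] k} [AddCommGroup V] [Module k V] [Module H V]
    [IsScalarTower k H V] [FiniteDimensional k V] [IsSimpleModule H V]

lemma finrank_sharp : Module.finrank k V = Module.finrank k (k ⊗[k] Module.Dual k V) := by
  rw [Module.finrank_tensorProduct, Module.finrank_self, one_mul, Subspace.dual_finrank_eq]

/-- If there is a nonzero `H`-linear map `V → L ⊗ V^∨`, then transposition is multiplication by
the indicator, which is a sign. -/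
lemma indicator_of_ne_zero (hS : IsInvolutory k H) (hα : IsCentralChar α)
    {f : homH (actRep k H V) (sharpRep (charRep α) (actRep k H V))} (hf : f ≠ 0) :
    indicator hS hα.isFlippable (actRep k H V) ∈ ({1, -1} : Set k) ∧
      transposition hS hα.isFlippable (actRep k H V) (actRep k H V) f =
        indicator hS hα.isFlippable (actRep k H V) • f :=
  trace_of_involution_homH finrank_sharp _ (transposition_transposition hS hα _) hf

lemma indicator_ne_zero_iff (hS : IsInvolutory k H) (hα : IsCentralChar α) :
    indicator hS hα.isFlippable (actRep k H V) ≠ 0 ↔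
      ∃ f : homH (actRep k H V) (sharpRep (charRep α) (actRep k H V)), f ≠ 0 := by
  constructor
  · intro h
    by_contra! h0
    exact h (indicator_eq_zero hS hα _ h0)
  · rintro ⟨f, hf⟩
    rcases (indicator_of_ne_zero hS hα hf).1 with h | h <;> rw [h] <;> simp

end Simple

end HopfRep

end

open HopfRep in
theorem theorem2p13 {k H V : Type*} [Field k] [IsAlgClosed k] [CharZero k] [Ring H]
    [HopfAlgebra k H] [FiniteDimensional k H] [IsSemisimpleRing H]
    (α : H →ₐ[k] k) (hα : IsCentralChar α)
    [AddCommGroup V] [Module k V] [Module H V] [IsScalarTower k H V] [FiniteDimensional k V]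
    [IsSimpleModule H V] :
    -- `S² = id`, so that the duality, and with it `ν(V; L)`, is defined
    ∃ hS : IsInvolutory k H,
      -- the Haar integral exists, and `ν(V; L) = α(S(Λ₍₁₎)) χ_V(Λ₍₂₎ Λ₍₃₎)`
      (∃! Λ : H, IsHaarIntegral k Λ) ∧
      (∀ Λ : H, IsHaarIntegral k Λ → indicator hS hα.isFlippable (actRep k H V) =
        indicatorFunctional α (actRep k H V) Λ) ∧
      indicator hS hα.isFlippable (actRep k H V) ∈ ({0, 1, -1} : Set k) ∧
      -- (1) ↔ (2)
      (indicator hS hα.isFlippable (actRep k H V) ≠ 0 ↔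
        IsIso (actRep k H V) (tensorRep (charRep α) (dualRep (actRep k H V)))) ∧
      -- (1) ↔ (3)
      (indicator hS hα.isFlippable (actRep k H V) ≠ 0 ↔
        ∃ b : LinearMap.BilinForm k V, b.Nondegenerate ∧
          IsInvariantForm α (actRep k H V) b) ∧
      -- uniqueness and symmetry of the form
      (∀ b b' : LinearMap.BilinForm k V,
        b.Nondegenerate → IsInvariantForm α (actRep k H V) b →
        b'.Nondegenerate → IsInvariantForm α (actRep k H V) b' →
          ∃ c : k, c ≠ 0 ∧ b' = c • b) ∧
      (∀ b : LinearMap.BilinForm k V,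
        b.Nondegenerate → IsInvariantForm α (actRep k H V) b →
          ∀ v w : V, b w v = indicator hS hα.isFlippable (actRep k H V) * b v w) := by
  have hS := isInvolutory_of_isSemisimpleRing k H
  have hV : Nontrivial V := IsSimpleModule.nontrivial H V
  have hform : ∀ b : LinearMap.BilinForm k V, b.Nondegenerate →
      IsInvariantForm α (actRep k H V) b →
      ∃ f : homH (actRep k H V) (sharpRep (charRep α) (actRep k H V)),
        f ≠ 0 ∧ formEquiv k V f.1 = b := by
    intro b hb hinv
    refine ⟨⟨(formEquiv k V).symm b, ?_⟩, ?_, (formEquiv k V).apply_symm_apply b⟩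
    · rwa [mem_homH_sharp_iff_isInvariantForm, LinearEquiv.apply_symm_apply]
    · intro h
      apply hb.ne_zero
      have := congrArg Subtype.val h
      exact (LinearEquiv.map_eq_zero_iff _).1 this
  refine ⟨hS, existsUnique_isHaarIntegral k H,
    fun Λ hΛ => indicator_eq_indicatorFunctional hS hα _ hΛ, ?_, ?_, ?_, ?_, ?_⟩
  · by_cases h : indicator hS hα.isFlippable (actRep k H V) = 0
    · exact Or.inl h
    · obtain ⟨f, hf⟩ := (indicator_ne_zero_iff hS hα).1 h
      exact Or.inr (indicator_of_ne_zero hS hα hf).1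
  · rw [indicator_ne_zero_iff hS hα]
    constructor
    · rintro ⟨f, hf⟩
      refine ⟨LinearEquiv.ofInjectiveOfFinrankEq f.1
        (injective_of_mem_homH f.2 fun h => hf (Subtype.ext h)) finrank_sharp, ?_⟩
      exact f.2
    · rintro ⟨e, he⟩
      refine ⟨⟨e.toLinearMap, he⟩, fun h => ?_⟩
      obtain ⟨v, hv⟩ := exists_ne (0 : V)
      exact hv (e.map_eq_zero_iff.1 congr($(h).1 v))
  · rw [indicator_ne_zero_iff hS hα]
    constructor
    · rintro ⟨f, hf⟩
      refine ⟨formEquiv k V f.1, ?_, (mem_homH_sharp_iff_isInvariantForm α _ f.1).1 f.2⟩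
      rw [LinearMap.BilinForm.nondegenerate_iff_ker_eq_bot, LinearMap.ker_eq_bot]
      exact (TensorProduct.lid k (Module.Dual k V)).injective.comp
        (injective_of_mem_homH f.2 fun h => hf (Subtype.ext h))
    · rintro ⟨b, hb, hinv⟩
      obtain ⟨f, hf, -⟩ := hform b hb hinv
      exact ⟨f, hf⟩
  · intro b b' hb hinv hb' hinv'
    obtain ⟨f, hf, rfl⟩ := hform b hb hinv
    obtain ⟨f', hf', rfl⟩ := hform b' hb' hinv'
    obtain ⟨c, hc⟩ := exists_eq_smul_of_mem_homH finrank_sharp f.2 f'.2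
      (fun h => hf (Subtype.ext h))
    refine ⟨c, ?_, by rw [hc, map_smul]⟩
    rintro rfl
    exact hf' (Subtype.ext (by rw [hc, zero_smul]; rfl))
  · intro b hb hinv v w
    obtain ⟨f, hf, rfl⟩ := hform b hb hinv
    have := congrArg (fun g => formEquiv k V g.1 v w) (indicator_of_ne_zero hS hα hf).2
    refine (formEquiv_transposition f.1 v w).symm.trans (this.trans ?_)
    change formEquiv k V (indicator hS hα.isFlippable (actRep k H V) • f.1) v w = _
    rw [map_smul]
    rfl
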